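/- **Setting.** Consider $\partial_t u=\operatorname{div}(a(u)\nabla u)$ and $A[u]:=-\operatorname{div}(a(u)\nabla u)$, either on a nonempty bounded open convex set $\Omega\subset\mathbb R^d$ with smooth boundary, with the homogeneous Neumann condition $\nabla u\cdot\nu=0$ on $\partial\Omega$, or on a box $\Omega$ with periodic boundary conditions. Consider a Runge–Kutta scheme with coefficients $a_{ij},b_i$ ($1\le i,j\le s$), $c_i=\sum_j a_{ij}$, $\sum_i b_i=1$, and set $C_{\rm RK}=2\sum_i b_i(1-c_i)$; one step of size $\tau$ reads $$u^k=u^{k-1}+\tau\sum_{i=1}^s b_iK_i,\qquad K_i=-A\Big[u^{k-1}+\tau\sum_{j=1}^s a_{ij}K_j\Big].$$ Let $S\subset\mathbb R$ be the interval of admissible values, let $a,h$ be smooth near each point of $S$ with $a\ge0$ and $h''\ge0$ on $S$, and let $\mu=a/h''$ be smooth near each point of $S$ (zeros of $h''$ are allowed if they have empty interior relative to $S$; there $\mu$ is the smooth continuation of the quotient). Let $H[u]=\int_\Omega h(u)\,dx$. **Structural conditions.** Let $u_0\in\overline S$ be such that $\mu\mu'h''$ is integrable between $u_0$ and every $u\in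 S$, and suppose that for all $u\in S$ $$b(u):=\tfrac23(C_{\rm RK}+2)\int_{u_0}^u\mu(v)\mu'(v)h''(v)\,dv\ \ge 0,\qquad \tfrac{d-1}{d}\,b(u)\le (C_{\rm RK}+1)h''(u)\mu(u)^2,$$ $$(C_{\rm RK}+2)\mu(u)\mu''(u)+(C_{\rm RK}-1)\mu'(u)^2<0.$$ **Solutions.** Let $k\ge1$, $\tau_0>0$, and for $0\le\tau<\tau_0$ let $u^{k-1}_\tau,u^k_\tau$ and the increments $K_{i,\tau}$ form a step of size $\tau$ of the scheme. Here $u^{k-1}_\tau$, $u^k_\tau$ and the stage values $u_\tau^{k-1}+\tau\sum_ja_{ij}K_{j,\tau}$ have values in $S$ on $\overline\Omega$ and satisfy the boundary condition, and $u_\tau^{k-1},u_\tau^k,K_{i,\tau}$ are smooth in $(\tau,x)$, up to $\tau=0$ and up to $\partial\Omega$ (smooth on $[0,\tau_0)\times\mathbb R^d$ in the periodic case). (For instance, $u^k_\tau=u^k$ may be independent of $\tau$.) Suppose that $u^k_\tau|_{\tau=0}$ is not constant in $\Omega$. **Conclusion.** Then there exists $\tau^k\in(0,\tau_0]$ such that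 for all $0<\tau<\tau^k$ $$H[u^k_\tau]+\tau\int_\Omega h''(u^k_\tau)\,a(u^k_\tau)\,|\nabla u^k_\tau|^2\,dx\ \le\ H[u^{k-1}_\tau].$$ -/

import Mathlib

open scoped ContDiff

noncomputable section

namespace RungeKuttaEntropy

/-- The coefficients `a i j`, `b i` of a Runge-Kutta scheme with `s` stages. -/
structure Tableau (s : ℕ) where
  a : Fin s → Fin s → ℝ
  b : Fin s → ℝ

/-- The knots `c i = ∑ j, a i j`. -/
def Tableau.c {s : ℕ} (T : Tableau s) (i : Fin s) : ℝ := ∑ j, T.a i j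

/-- Consistency `∑ i, b i = 1` (the other consistency relation, `∑ j, a i j = c i`, is the
definition of the knots). -/
def Tableau.IsConsistent {s : ℕ} (T : Tableau s) : Prop := ∑ i, T.b i = 1

/-- The number `C_RK = 2 ∑ i, b i (1 - c i)`. -/
def Tableau.CRK {s : ℕ} (T : Tableau s) : ℝ := 2 * ∑ i, T.b i * (1 - T.c i)

/-- The divergence `∑ i, ∂ᵢ Fᵢ` of a vector field. -/
def divergence {d : ℕ} (F : EuclideanSpace ℝ (Fin d) → EuclideanSpace ℝ (Fin d))
    (x : EuclideanSpace ℝ (Fin d)) : ℝ :=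
  ∑ i, fderiv ℝ (fun y => F y i) x (EuclideanSpace.single i 1)

/-- The diffusion operator `A[u] = - div (a(u) ∇u)`, evaluated at interior points. -/
def diffusionOp {d : ℕ} (a : ℝ → ℝ) (u : EuclideanSpace ℝ (Fin d) → ℝ)
    (x : EuclideanSpace ℝ (Fin d)) : ℝ :=
  -divergence (fun y => a (u y) • gradient u y) x

/-- `φ` is a smooth defining function of `Ω` near the boundary point `p`: close to `p`, the set
`Ω` is `{φ < 0}`, and `φ p = 0`, `∇φ p ≠ 0`. -/
structure IsLocalDefiningFunction {d : ℕ} (Ω : Set (EuclideanSpace ℝ (Fin d)))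
    (p : EuclideanSpace ℝ (Fin d)) (φ : EuclideanSpace ℝ (Fin d) → ℝ) : Prop where
  smooth : ContDiffAt ℝ ∞ φ p
  zero : φ p = 0
  gradient_ne_zero : gradient φ p ≠ 0
  mem_iff : ∀ᶠ x in nhds p, x ∈ Ω ↔ φ x < 0

/-- `Ω` has a smooth boundary and lies locally on one side of it. -/
def HasSmoothBoundary {d : ℕ} (Ω : Set (EuclideanSpace ℝ (Fin d))) : Prop :=
  ∀ p ∈ frontier Ω, ∃ φ, IsLocalDefiningFunction Ω p φ

/-- `ν` is the outer unit normal of `Ω` at the boundary point `p`. -/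
def IsOuterUnitNormal {d : ℕ} (Ω : Set (EuclideanSpace ℝ (Fin d)))
    (p ν : EuclideanSpace ℝ (Fin d)) : Prop :=
  ∃ φ, IsLocalDefiningFunction Ω p φ ∧ ν = ‖gradient φ p‖⁻¹ • gradient φ p

/-- Homogeneous Neumann conditions, or periodic conditions with periods `L i`. -/
inductive BoundaryCondition (d : ℕ) where
  | neumann : BoundaryCondition d
  | periodic (L : Fin d → ℝ) : BoundaryCondition d

/-- The domains: for Neumann conditions, nonempty bounded open convex sets with smooth boundary;
for periodic conditions, the boxes with side lengths `L i > 0`. -/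
def BoundaryCondition.IsDomain {d : ℕ} :
    BoundaryCondition d → Set (EuclideanSpace ℝ (Fin d)) → Prop
  | .neumann, Ω =>
      IsOpen Ω ∧ Ω.Nonempty ∧ Bornology.IsBounded Ω ∧ Convex ℝ Ω ∧ HasSmoothBoundary Ω
  | .periodic L, Ω =>
      (∀ i, 0 < L i) ∧
        ∃ p : Fin d → ℝ, Ω = {x | ∀ i, x i ∈ Set.Ioo (p i) (p i + L i)}

/-- The set on which the functions are required to be smooth: up to the boundary for Neumann
conditions, and on the whole space (as periodic functions) for periodic conditions. -/
def BoundaryCondition.region {d : ℕ} :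
    BoundaryCondition d → Set (EuclideanSpace ℝ (Fin d)) → Set (EuclideanSpace ℝ (Fin d))
  | .neumann, Ω => closure Ω
  | .periodic _, _ => Set.univ

/-- The boundary condition: `∇f · ν = 0` on the boundary, respectively periodicity. -/
def BoundaryCondition.Holds {d : ℕ} : BoundaryCondition d →
    Set (EuclideanSpace ℝ (Fin d)) → (EuclideanSpace ℝ (Fin d) → ℝ) → Prop
  | .neumann, Ω, f =>
      ∀ p ∈ frontier Ω, ∀ ν, IsOuterUnitNormal Ω p ν → fderivWithin ℝ f (closure Ω) p ν = 0
  | .periodic L, _, f => ∀ i x, f (x + EuclideanSpace.single i (L i)) = f x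

/-- The argument `v + τ ∑ j, a i j K j` of the operator in the `i`-th stage. -/
def stage {d s : ℕ} (T : Tableau s) (τ : ℝ) (v : EuclideanSpace ℝ (Fin d) → ℝ)
    (K : Fin s → EuclideanSpace ℝ (Fin d) → ℝ) (i : Fin s)
    (x : EuclideanSpace ℝ (Fin d)) : ℝ :=
  v x + τ * ∑ j, T.a i j * K j x

/-- `f` satisfies the boundary condition and takes admissible values, i.e. values in `S`. -/
def IsAdmissible {d : ℕ} (S : Set ℝ) (bc : BoundaryCondition d)
    (Ω : Set (EuclideanSpace ℝ (Fin d))) (f : EuclideanSpace ℝ (Fin d) → ℝ) : Prop :=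
  bc.Holds Ω f ∧ ∀ x ∈ closure Ω, f x ∈ S

/-- One step of size `τ` of the Runge-Kutta scheme for `∂ₜ u = div (a(u) ∇u)`, leading from
`v = u^{k-1}` to `w = u^k` with stage increments `K i = -A[v + τ ∑ j, a i j K j]`. -/
structure IsStep {d s : ℕ} (T : Tableau s) (a : ℝ → ℝ) (S : Set ℝ) (bc : BoundaryCondition d)
    (Ω : Set (EuclideanSpace ℝ (Fin d))) (τ : ℝ) (v w : EuclideanSpace ℝ (Fin d) → ℝ)
    (K : Fin s → EuclideanSpace ℝ (Fin d) → ℝ) : Prop where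
  old_admissible : IsAdmissible S bc Ω v
  new_admissible : IsAdmissible S bc Ω w
  stage_admissible : ∀ i, IsAdmissible S bc Ω (stage T τ v K i)
  increment_eq : ∀ i, ∀ x ∈ Ω, K i x = -diffusionOp a (stage T τ v K i) x
  new_eq : ∀ x ∈ Ω, w x = v x + τ * ∑ i, T.b i * K i x

/-- `f τ x` is smooth in `(τ, x)` for `0 ≤ τ < τ₀`, up to `τ = 0`, and `x` in the region `D`. -/
def IsSmoothFamily {d : ℕ} (τ₀ : ℝ) (D : Set (EuclideanSpace ℝ (Fin d)))
    (f : ℝ → EuclideanSpace ℝ (Fin d) → ℝ) : Prop :=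
  ContDiffOn ℝ ∞ (fun q : ℝ × EuclideanSpace ℝ (Fin d) => f q.1 q.2) (Set.Ico 0 τ₀ ×ˢ D)

/-- The entropy `H[u] = ∫_Ω h(u) dx`. -/
def entropy {d : ℕ} (h : ℝ → ℝ) (Ω : Set (EuclideanSpace ℝ (Fin d)))
    (u : EuclideanSpace ℝ (Fin d) → ℝ) : ℝ :=
  ∫ x in Ω, h (u x)

/-- The entropy production `∫_Ω h''(u) a(u) |∇u|² dx`. -/
def entropyProduction {d : ℕ} (a h : ℝ → ℝ) (Ω : Set (EuclideanSpace ℝ (Fin d)))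
    (u : EuclideanSpace ℝ (Fin d) → ℝ) : ℝ :=
  ∫ x in Ω, deriv (deriv h) (u x) * a (u x) * ‖gradient u x‖ ^ 2

/-- The function `b(u) = (2/3) (C + 2) ∫_{u₀}^u μ(v) μ'(v) h''(v) dv`. -/
def bFun (C : ℝ) (μ h : ℝ → ℝ) (u₀ u : ℝ) : ℝ :=
  2 / 3 * (C + 2) * ∫ v in u₀..u, μ v * deriv μ v * deriv (deriv h) v

end RungeKuttaEntropy

end

/-!
# Entropy dissipation of Runge-Kutta schemes for `∂ₜ u = div (a(u) ∇u)`

Write `v = u^{k-1}`, `u = u^k`, `g = h''(u)`, `w = h'(u)`, `κ = div (a(u) ∇u)`, and let `C = C_RK`.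
On the domain the scheme says `v = u - τ ∑ bᵢ Kᵢ`, and the `i`-th stage is the perturbation
`u + τ ∑ⱼ (aᵢⱼ - bⱼ) Kⱼ` of the *new* value. In `H[v] - H[u] - τ ∫ g a(u) |∇u|²` the terms of order
`τ` cancel after integration by parts (`IsStep.entropy_balance`), and division by `τ²` leaves an
integral which, as `τ → 0`, converges by dominated convergence to
`½ ∫ (g κ² - C ⟨∇w, ∇(a(u) κ)⟩)` at `τ = 0` (`convergesBoundedly_stepDensity`). This number is
positive, which proves the theorem.

For the positivity (`StructuralConditions.second_variation_pos`), another integration by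
parts turns the integrand into `g κ² + C a(u) κ Δw`, and `κ = μ Δw + μ' ⟨∇u, ∇w⟩`. Two divergences are
added: `div (B(u) |∇w|² ∇w)` with `B = -⅓ (C + 2) μ μ'`, whose integral vanishes, and the Bochner
term `div (b(u) (∇²w ∇w - Δw ∇w))`, whose integral is nonpositive. The coefficients are such
that all terms with `∇²w ∇w` or `|∇w|² Δw` cancel. The remainder is
`((C + 1) g μ² - b) (Δw)² + b |∇²w|²`, nonnegative by `|∇²w|² ≥ (Δw)² / d` and the bound on `b`, plus
`-⅓ ((C + 2) μ μ'' + (C - 1) μ'²) |∇w|² ⟨∇u, ∇w⟩` (`bochner_algebra_le`). The last term is not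
identically zero, because `g ∇u = 0` everywhere would make `h'` constant on the interval of
values of `u`.

In the periodic case the integrations by parts are the divergence theorem on a box. In the
Neumann case only the inequality `∫ div F ≤ 0` for fields with nonpositive boundary flux is
needed (equalities follow by changing the sign of `F`), and it is proved by testing with the
cutoff functions `min 1 (n dist(x, Ωᶜ))`: their gradient at `x` points away from a nearest
boundary point, where the flux condition applies (`integral_sum_lineDeriv_nonpos`). The flux of the
Bochner term has the right sign on convex domains because normals of a convex set are monotone
(`IsLocalDefiningFunction.inner_fderivWithin_nonpos`).
-/


noncomputable section

namespace RungeKuttaEntropy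

open Set Filter Topology MeasureTheory

section

/-- The Euclidean space `ℝᵈ`. -/
abbrev Space (d : ℕ) : Type := EuclideanSpace ℝ (Fin d)

variable {d : ℕ}

/-! ### Partial derivatives within a set -/

/-- The partial derivative `∂ᵢ f` relative to the set `D`, so that it makes sense up to the
boundary of `D`. -/
def pd (D : Set (Space d)) (i : Fin d) (f : Space d → ℝ) (x : Space d) : ℝ :=
  fderivWithin ℝ f D x (EuclideanSpace.single i 1)

variable {D : Set (Space d)} {f g : Space d → ℝ} {x : Space d} {i j : Fin d}

theorem fderivWithin_apply_eq_sum_pd (v : Space d) :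
    fderivWithin ℝ f D x v = ∑ i, v i * pd D i f x := by
  have hv : v = ∑ i, v i • EuclideanSpace.single i (1 : ℝ) := by
    ext j
    simp [Finset.sum_apply, Pi.single_apply]
  conv_lhs => rw [hv]
  simp [pd, map_sum]

theorem pd_eq_fderiv (hx : D ∈ 𝓝 x) : pd D i f x = fderiv ℝ f x (EuclideanSpace.single i 1) := by
  rw [pd, fderivWithin_of_mem_nhds hx]

theorem pd_congr (h : EqOn f g D) (hx : x ∈ D) : pd D i f x = pd D i g x := by
  rw [pd, pd, fderivWithin_congr h (h hx)]

theorem pd_mul (hD : UniqueDiffOn ℝ D) (hx : x ∈ D) (hf : DifferentiableOn ℝ f D)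
    (hg : DifferentiableOn ℝ g D) :
    pd D i (fun y => f y * g y) x = pd D i f x * g x + f x * pd D i g x := by
  rw [pd, fderivWithin_fun_mul (hD x hx) (hf x hx) (hg x hx)]
  simp [pd]
  ring

theorem pd_const_mul (hD : UniqueDiffOn ℝ D) (hx : x ∈ D) (hf : DifferentiableOn ℝ f D) (c : ℝ) :
    pd D i (fun y => c * f y) x = c * pd D i f x := by
  rw [pd, fderivWithin_const_mul (hD x hx) (hf x hx)]
  simp [pd]

theorem pd_add (hD : UniqueDiffOn ℝ D) (hx : x ∈ D) (hf : DifferentiableOn ℝ f D)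
    (hg : DifferentiableOn ℝ g D) :
    pd D i (fun y => f y + g y) x = pd D i f x + pd D i g x := by
  rw [pd, fderivWithin_fun_add (hD x hx) (hf x hx) (hg x hx)]
  simp [pd]

theorem pd_sub (hD : UniqueDiffOn ℝ D) (hx : x ∈ D) (hf : DifferentiableOn ℝ f D)
    (hg : DifferentiableOn ℝ g D) :
    pd D i (fun y => f y - g y) x = pd D i f x - pd D i g x := by
  rw [pd, fderivWithin_fun_sub (hD x hx) (hf x hx) (hg x hx)]
  simp [pd]

theorem pd_sum {ι : Type*} [Fintype ι] (hD : UniqueDiffOn ℝ D) (hx : x ∈ D)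
    {F : ι → Space d → ℝ} (hF : ∀ k, DifferentiableOn ℝ (F k) D) :
    pd D i (fun y => ∑ k, F k y) x = ∑ k, pd D i (F k) x := by
  rw [pd, fderivWithin_fun_sum (hD x hx) fun k _ => hF k x hx]
  simp [pd]

theorem pd_comp (hD : UniqueDiffOn ℝ D) (hx : x ∈ D) (hf : DifferentiableOn ℝ f D) {φ : ℝ → ℝ}
    (hφ : DifferentiableAt ℝ φ (f x)) :
    pd D i (fun y => φ (f y)) x = deriv φ (f x) * pd D i f x := by
  have := (hφ.hasDerivAt.comp_hasFDerivWithinAt x (hf x hx).hasFDerivWithinAt).fderivWithin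
    (hD x hx)
  rw [pd, show (fun y => φ (f y)) = φ ∘ f from rfl, this]
  simp [pd]

theorem contDiffOn_pd (hD : UniqueDiffOn ℝ D) (hf : ContDiffOn ℝ ∞ f D) (i : Fin d) :
    ContDiffOn ℝ ∞ (pd D i f) D :=
  (hf.fderivWithin hD (by simp)).clm_apply contDiffOn_const

theorem continuousOn_pd (hD : UniqueDiffOn ℝ D) (hf : ContDiffOn ℝ 1 f D) (i : Fin d) :
    ContinuousOn (pd D i f) D :=
  ((hf.continuousOn_fderivWithin hD (by simp)).clm_apply continuousOn_const)

theorem pd_symm (hD : UniqueDiffOn ℝ D) (hf : ContDiffOn ℝ ∞ f D) (hx : x ∈ D)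
    (hx' : x ∈ closure (interior D)) : pd D i (pd D j f) x = pd D j (pd D i f) x := by
  have hd : DifferentiableWithinAt ℝ (fderivWithin ℝ f D) D x :=
    (hf.fderivWithin hD (m := 1) (by norm_cast)).differentiableOn (by simp) x hx
  have key : ∀ k l : Fin d, pd D k (pd D l f) x =
      fderivWithin ℝ (fderivWithin ℝ f D) D x (EuclideanSpace.single k 1)
        (EuclideanSpace.single l 1) := by
    intro k l
    have := (hd.hasFDerivWithinAt.clm_apply
      (hasFDerivWithinAt_const (EuclideanSpace.single l (1 : ℝ)) x D)).fderivWithin (hD x hx)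
    rw [pd, show pd D l f = fun y => fderivWithin ℝ f D y (EuclideanSpace.single l 1) from rfl,
      this]
    simp
  rw [key, key]
  have h2 : minSmoothness ℝ 2 ≤ (∞ : WithTop ℕ∞) := by
    rw [minSmoothness_of_isRCLikeNormedField]
    exact WithTop.coe_le_coe.2 le_top
  exact ((hf x hx).isSymmSndFDerivWithinAt h2 hD hx' hx).eq _ _

theorem contDiffOn_comp_of_forall_mem {φ : ℝ → ℝ} {S : Set ℝ} {n : WithTop ℕ∞}
    (hφ : ∀ u ∈ S, ContDiffAt ℝ n φ u) (hf : ContDiffOn ℝ n f D) (hm : ∀ x ∈ D, f x ∈ S) :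
    ContDiffOn ℝ n (fun x => φ (f x)) D :=
  fun x hx => (hφ (f x) (hm x hx)).comp_contDiffWithinAt x (hf x hx)

theorem contDiffAt_infty_deriv {φ : ℝ → ℝ} {u : ℝ} (h : ContDiffAt ℝ ∞ φ u) :
    ContDiffAt ℝ ∞ (deriv φ) u := by
  have h1 := h.fderiv_right (m := ∞) (by simp)
  have : deriv φ = fun x => fderiv ℝ φ x 1 := by ext x; simp
  rw [this]
  exact h1.clm_apply contDiffAt_const

/-! ### Domains and boundary conditions -/

variable {bc : BoundaryCondition d} {Ω : Set (Space d)}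

theorem box_eq_preimage (p q : Fin d → ℝ) :
    {x : Space d | ∀ i, x i ∈ Ioo (p i) (q i)} =
      (EuclideanSpace.equiv (Fin d) ℝ) ⁻¹' (univ.pi fun i => Ioo (p i) (q i)) := by
  ext x
  simp

theorem BoundaryCondition.IsDomain.isOpen (h : bc.IsDomain Ω) : IsOpen Ω := by
  cases bc with
  | neumann => exact h.1
  | periodic L =>
    obtain ⟨_, p, rfl⟩ := h
    rw [box_eq_preimage]
    exact (isOpen_set_pi finite_univ fun i _ => isOpen_Ioo).preimage
      (EuclideanSpace.equiv (Fin d) ℝ).continuous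

theorem BoundaryCondition.IsDomain.convex (h : bc.IsDomain Ω) : Convex ℝ Ω := by
  cases bc with
  | neumann => exact h.2.2.2.1
  | periodic L =>
    obtain ⟨_, p, rfl⟩ := h
    rw [box_eq_preimage]
    exact (convex_pi fun i _ => convex_Ioo (p i) _).linear_preimage
      (EuclideanSpace.equiv (Fin d) ℝ).toLinearMap

theorem BoundaryCondition.IsDomain.nonempty (h : bc.IsDomain Ω) : Ω.Nonempty := by
  cases bc with
  | neumann => exact h.2.1
  | periodic L =>
    obtain ⟨hL, p, rfl⟩ := h
    refine ⟨WithLp.toLp 2 fun i => p i + L i / 2, fun i => ?_⟩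
    have := hL i
    constructor <;> simp <;> linarith

theorem closedBox_eq_preimage (p q : Fin d → ℝ) :
    {x : Space d | ∀ i, x i ∈ Icc (p i) (q i)} =
      (EuclideanSpace.equiv (Fin d) ℝ) ⁻¹' (Icc p q) := by
  ext x
  simp [Pi.le_def, forall_and]

theorem isCompact_closedBox (p q : Fin d → ℝ) :
    IsCompact {x : Space d | ∀ i, x i ∈ Icc (p i) (q i)} := by
  rw [closedBox_eq_preimage]
  exact (EuclideanSpace.equiv (Fin d) ℝ).toHomeomorph.isCompact_preimage.2 isCompact_Icc

theorem closure_box (p q : Fin d → ℝ) (hpq : ∀ i, p i < q i) :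
    closure {x : Space d | ∀ i, x i ∈ Ioo (p i) (q i)} = {x | ∀ i, x i ∈ Icc (p i) (q i)} := by
  rw [box_eq_preimage, closedBox_eq_preimage]
  have := (EuclideanSpace.equiv (Fin d) ℝ).toHomeomorph.preimage_closure
    (univ.pi fun i => Ioo (p i) (q i))
  rw [closure_pi_set] at this
  simp only [closure_Ioo (hpq _).ne] at this
  rw [← pi_univ_Icc]
  exact this.symm

theorem BoundaryCondition.IsDomain.isCompact_closure (h : bc.IsDomain Ω) :
    IsCompact (closure Ω) := by
  cases bc with
  | neumann => exact h.2.2.1.isCompact_closure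
  | periodic L =>
    obtain ⟨hL, p, rfl⟩ := h
    exact (isCompact_closedBox p fun i => p i + L i).closure_of_subset
      fun x hx i => Ioo_subset_Icc_self (hx i)

theorem BoundaryCondition.closure_subset_region (bc : BoundaryCondition d) (Ω : Set (Space d)) :
    closure Ω ⊆ bc.region Ω := by
  cases bc with
  | neumann => exact Subset.rfl
  | periodic L => exact subset_univ _

theorem BoundaryCondition.subset_region (bc : BoundaryCondition d) (Ω : Set (Space d)) :
    Ω ⊆ bc.region Ω :=
  subset_closure.trans (bc.closure_subset_region Ω)

theorem BoundaryCondition.IsDomain.region_mem_nhds (h : bc.IsDomain Ω) (hx : x ∈ Ω) :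
    bc.region Ω ∈ 𝓝 x :=
  mem_of_superset (h.isOpen.mem_nhds hx) (bc.subset_region Ω)

theorem BoundaryCondition.IsDomain.uniqueDiffOn (h : bc.IsDomain Ω) :
    UniqueDiffOn ℝ (bc.region Ω) := by
  cases bc with
  | neumann =>
    refine uniqueDiffOn_convex h.convex.closure ?_
    exact h.nonempty.mono (h.isOpen.subset_interior_iff.2 subset_closure)
  | periodic L => exact uniqueDiffOn_univ

theorem BoundaryCondition.IsDomain.pd_symm (h : bc.IsDomain Ω)
    (hf : ContDiffOn ℝ ∞ f (bc.region Ω)) (hx : x ∈ Ω) :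
    pd (bc.region Ω) i (pd (bc.region Ω) j f) x = pd (bc.region Ω) j (pd (bc.region Ω) i f) x :=
  RungeKuttaEntropy.pd_symm h.uniqueDiffOn hf (bc.subset_region Ω hx)
    (subset_closure (mem_interior_iff_mem_nhds.2 (h.region_mem_nhds hx)))

theorem BoundaryCondition.IsDomain.integrableOn (h : bc.IsDomain Ω)
    (hf : ContinuousOn f (bc.region Ω)) : IntegrableOn f Ω :=
  ((hf.mono (bc.closure_subset_region Ω)).integrableOn_compact h.isCompact_closure).mono_set
    subset_closure

/-- Coefficient functions that keep the boundary condition of a flux when it is multiplied by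
them: arbitrary ones for Neumann conditions, periodic ones for periodic conditions. -/
def BoundaryCondition.Invariant : BoundaryCondition d → (Space d → ℝ) → Prop
  | .neumann, _ => True
  | .periodic L, f => ∀ i x, f (x + EuclideanSpace.single i (L i)) = f x

theorem BoundaryCondition.Holds.invariant (h : bc.Holds Ω f) : bc.Invariant f := by
  cases bc with
  | neumann => trivial
  | periodic L => exact h

theorem BoundaryCondition.Invariant.comp (h : bc.Invariant f) (φ : ℝ → ℝ) :
    bc.Invariant fun x => φ (f x) := by
  cases bc with
  | neumann => trivial
  | periodic L => exact fun i x => congrArg φ (h i x)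

theorem BoundaryCondition.Invariant.mul (hf : bc.Invariant f) (hg : bc.Invariant g) :
    bc.Invariant fun x => f x * g x := by
  cases bc with
  | neumann => trivial
  | periodic L => exact fun i x => congrArg₂ (· * ·) (hf i x) (hg i x)

theorem BoundaryCondition.Invariant.sub (hf : bc.Invariant f) (hg : bc.Invariant g) :
    bc.Invariant fun x => f x - g x := by
  cases bc with
  | neumann => trivial
  | periodic L => exact fun i x => congrArg₂ (· - ·) (hf i x) (hg i x)

theorem BoundaryCondition.Invariant.sum {ι : Type*} [Fintype ι] {F : ι → Space d → ℝ}
    (hF : ∀ k, bc.Invariant (F k)) : bc.Invariant fun x => ∑ k, F k x := by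
  cases bc with
  | neumann => trivial
  | periodic L => exact fun i x => Finset.sum_congr rfl fun k _ => hF k i x

theorem BoundaryCondition.Invariant.pd (hf : bc.Invariant f) (j : Fin d) :
    bc.Invariant (pd (bc.region Ω) j f) := by
  cases bc with
  | neumann => trivial
  | periodic L =>
    intro i x
    have hf' : (fun y => f (y + EuclideanSpace.single i (L i))) = f := funext (hf i)
    simp only [BoundaryCondition.region, RungeKuttaEntropy.pd, fderivWithin_univ]
    conv_rhs => rw [← hf', fderiv_comp_add_right]

/-- An admissible function takes admissible values on the whole region on which it is smooth. -/
theorem IsAdmissible.mem_of_mem_region {S : Set ℝ} (h : IsAdmissible S bc Ω f)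
    (hΩ : bc.IsDomain Ω) (hx : x ∈ bc.region Ω) : f x ∈ S := by
  cases bc with
  | neumann => exact h.2 x hx
  | periodic L =>
    obtain ⟨hL, p, rfl⟩ := hΩ
    have hper := h.1
    have hz : ∀ (i : Fin d) (n : ℤ) (y : Space d),
        f (y + n • EuclideanSpace.single i (L i)) = f y := fun i n y =>
      Function.Periodic.zsmul (hper i) n y
    have hs : ∀ (s : Finset (Fin d)) (n : Fin d → ℤ) (y : Space d),
        f (y + ∑ i ∈ s, n i • EuclideanSpace.single i (L i)) = f y := by
      intro s n
      induction s using Finset.induction_on with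
      | empty => simp
      | insert a s ha ih =>
        intro y
        rw [Finset.sum_insert ha, ← add_assoc, ih, hz]
    have key := hs Finset.univ (fun i => -toIcoDiv (hL i) (p i) (x i)) x
    rw [← key]
    refine h.2 _ ?_
    rw [closure_box _ _ fun i => by linarith [hL i]]
    intro i
    have h1 := toIcoMod_mem_Ico (hL i) (p i) (x i)
    have h2 : (x + ∑ j, (-toIcoDiv (hL j) (p j) (x j)) • EuclideanSpace.single j (L j) :
        Space d) i = toIcoMod (hL i) (p i) (x i) := by
      simp [toIcoMod, Pi.single_apply, sub_eq_add_neg]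
    rw [h2]
    exact Ico_subset_Icc_self h1

end

/-! ### The divergence inequality on a bounded domain -/

section

variable {d : ℕ}

/-- The cutoff function `min 1 (n dist(x, Ωᶜ))`, which vanishes outside `Ω` and equals `1` at
distance at least `1 / n` from the complement. -/
def cutoff (Ω : Set (Space d)) (n : ℝ) (x : Space d) : ℝ := min 1 (n * Metric.infDist x Ωᶜ)

section Cutoff

variable {Ω : Set (Space d)} {n : ℝ} {x y : Space d}

theorem cutoff_nonneg (hn : 0 ≤ n) : 0 ≤ cutoff Ω n x :=
  le_min zero_le_one (mul_nonneg hn Metric.infDist_nonneg)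

theorem cutoff_le_one : cutoff Ω n x ≤ 1 := min_le_left _ _

theorem cutoff_eq_zero (hx : x ∉ Ω) : cutoff Ω n x = 0 := by
  simp [cutoff, Metric.infDist_zero_of_mem (show x ∈ Ωᶜ from hx)]

theorem lipschitzWith_cutoff (hn : 0 ≤ n) : LipschitzWith n.toNNReal (cutoff Ω n) := by
  have h1 : LipschitzWith n.toNNReal fun x : Space d => n * Metric.infDist x Ωᶜ := by
    refine LipschitzWith.of_dist_le_mul fun x y => ?_
    have h := (Metric.lipschitz_infDist_pt Ωᶜ).dist_le_mul x y
    rw [Real.dist_eq] at h ⊢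
    rw [← mul_sub, abs_mul, abs_of_nonneg hn, Real.coe_toNNReal n hn]
    exact mul_le_mul_of_nonneg_left (by simpa using h) hn
  exact h1.const_min 1

theorem infDist_compl_pos (hΩ : IsOpen Ω) (hc : Ωᶜ.Nonempty) (hx : x ∈ Ω) :
    0 < Metric.infDist x Ωᶜ :=
  (hΩ.isClosed_compl.notMem_iff_infDist_pos hc).1 (by simpa using hx)

/-- At a point within distance `1 / n` of the complement, the gradient of the cutoff function
has length `n` and points away from a nearest boundary point `y`. -/
theorem fderiv_cutoff_of_nearest (hn : 0 < n) (hxy : x ≠ y) (hy : y ∉ Ω)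
    (hd : Metric.infDist x Ωᶜ = dist x y) (hlt : n * Metric.infDist x Ωᶜ < 1)
    (hdiff : DifferentiableAt ℝ (cutoff Ω n) x) (v : Space d) :
    fderiv ℝ (cutoff Ω n) x v = n * (dist x y)⁻¹ * inner ℝ (x - y) v := by
  have hval : cutoff Ω n x = n * dist x y := by
    rw [cutoff, min_eq_right hlt.le, hd]
  -- `n² |z - y|² - χ(z)²` is nonnegative and vanishes at `x`
  have hmin : IsLocalMin (fun z => n ^ 2 * ‖z - y‖ ^ 2 - cutoff Ω n z ^ 2) x := by
    refine Eventually.of_forall fun z => ?_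
    have h0 : cutoff Ω n z ≤ n * ‖z - y‖ := by
      refine (min_le_right _ _).trans (mul_le_mul_of_nonneg_left ?_ hn.le)
      rw [← dist_eq_norm]
      exact Metric.infDist_le_dist_of_mem hy
    have h1 : cutoff Ω n z ^ 2 ≤ (n * ‖z - y‖) ^ 2 :=
      pow_le_pow_left₀ (cutoff_nonneg hn.le) h0 2
    have h2 : n ^ 2 * ‖x - y‖ ^ 2 - cutoff Ω n x ^ 2 = 0 := by
      rw [hval, dist_eq_norm]; ring
    have h3 : (n * ‖z - y‖) ^ 2 = n ^ 2 * ‖z - y‖ ^ 2 := by ring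
    linarith
  have hder := (((hasFDerivAt_id x).sub_const y).norm_sq.const_mul (n ^ 2)).sub
    (hdiff.hasFDerivAt.pow 2)
  have h0 := congrArg (fun L => L v) (hmin.hasFDerivAt_eq_zero hder)
  simp [hval] at h0
  have hpos : 0 < dist x y := dist_pos.2 hxy
  field_simp
  have : 2 * n * (n * inner ℝ (x - y) v - dist x y * fderiv ℝ (cutoff Ω n) x v) = 0 := by
    simp only [inner_sub_left]
    linarith
  have h4 := (mul_eq_zero.1 this).resolve_left (by positivity)
  linarith

/-- The boundary layer in which the cutoff function is not constant. -/
def shell (Ω : Set (Space d)) (n : ℝ) : Set (Space d) :=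
  {x ∈ Ω | n * Metric.infDist x Ωᶜ < 1}

theorem measurableSet_shell (hΩ : IsOpen Ω) : MeasurableSet (shell Ω n) :=
  hΩ.measurableSet.inter (isOpen_lt (continuous_const.mul (Metric.continuous_infDist_pt Ωᶜ))
    continuous_const).measurableSet

theorem fderiv_cutoff_of_notMem_shell (hn : 0 < n) (hx : x ∉ shell Ω n)
    (hdiff : DifferentiableAt ℝ (cutoff Ω n) x) : fderiv ℝ (cutoff Ω n) x = 0 := by
  by_cases hxΩ : x ∈ Ω
  · have h1 : cutoff Ω n x = 1 := by
      refine min_eq_left (not_lt.1 fun h => hx ⟨hxΩ, h⟩)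
    have hmax : IsLocalMax (cutoff Ω n) x :=
      Eventually.of_forall fun z => by rw [h1]; exact cutoff_le_one
    exact hmax.hasFDerivAt_eq_zero hdiff.hasFDerivAt
  · have hmin : IsLocalMin (cutoff Ω n) x :=
      Eventually.of_forall fun z => by rw [cutoff_eq_zero hxΩ]; exact cutoff_nonneg hn.le
    exact hmin.hasFDerivAt_eq_zero hdiff.hasFDerivAt

theorem exists_nearest_frontier (hΩ : IsOpen Ω) (hc : Ωᶜ.Nonempty) (hx : x ∈ Ω) :
    ∃ y ∈ frontier Ω, x ≠ y ∧ y ∉ Ω ∧ Metric.infDist x Ωᶜ = dist x y ∧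
      Metric.ball x (dist x y) ⊆ Ω := by
  obtain ⟨y, hy, hd⟩ := hΩ.isClosed_compl.exists_infDist_eq_dist hc x
  have hne : x ≠ y := fun h => hy (h ▸ hx)
  have hball : Metric.ball x (dist x y) ⊆ Ω := by
    intro z hz
    by_contra hzΩ
    have h1 : Metric.infDist x Ωᶜ ≤ dist x z := Metric.infDist_le_dist_of_mem hzΩ
    rw [Metric.mem_ball, dist_comm] at hz
    linarith
  refine ⟨y, ?_, hne, hy, hd, hball⟩
  rw [frontier, hΩ.interior_eq]
  refine ⟨closure_mono hball ?_, hy⟩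
  rw [closure_ball x (dist_pos.2 hne).ne', Metric.mem_closedBall, dist_comm]

/-- If the flux of a Lipschitz field is nonpositive on the boundary, the flux term created by the
cutoff function is bounded, uniformly in `n`, and lives in the boundary layer. -/
theorem neg_sum_fderiv_cutoff_le (hΩ : IsOpen Ω) (hc : Ωᶜ.Nonempty) (hn : 0 < n)
    {F : Fin d → Space d → ℝ} {C : Fin d → NNReal} (hF : ∀ i, LipschitzWith (C i) (F i))
    (hflux : ∀ x ∈ Ω, ∀ y ∈ frontier Ω, Metric.ball x (dist x y) ⊆ Ω →
      ∑ i, (y i - x i) * F i y ≤ 0)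
    (hdiff : DifferentiableAt ℝ (cutoff Ω n) x) :
    ∑ i, fderiv ℝ (cutoff Ω n) x (-EuclideanSpace.single i 1) * F i x ≤
      (shell Ω n).indicator (fun _ => ∑ i, (C i : ℝ)) x := by
  by_cases hx : x ∈ shell Ω n
  · rw [indicator_of_mem hx]
    obtain ⟨y, hyf, hxy, hy, hd, hball⟩ := exists_nearest_frontier hΩ hc hx.1
    have hpos : 0 < dist x y := dist_pos.2 hxy
    have h1 : ∀ i, fderiv ℝ (cutoff Ω n) x (-EuclideanSpace.single i 1) * F i x =
        n * (dist x y)⁻¹ * ((y i - x i) * (F i x - F i y)) +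
          n * (dist x y)⁻¹ * ((y i - x i) * F i y) := by
      intro i
      rw [map_neg, fderiv_cutoff_of_nearest hn hxy hy hd hx.2 hdiff]
      simp only [EuclideanSpace.inner_single_right, PiLp.sub_apply]
      simp
      ring
    have h2 : ∀ i, n * (dist x y)⁻¹ * ((y i - x i) * (F i x - F i y)) ≤ C i := by
      intro i
      have ha : |y i - x i| ≤ dist x y := by
        rw [dist_comm, dist_eq_norm]
        simpa using PiLp.norm_apply_le (y - x) i
      have hb : |F i x - F i y| ≤ C i * dist x y := by
        simpa [Real.dist_eq] using (hF i).dist_le_mul x y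
      have hc : (y i - x i) * (F i x - F i y) ≤ dist x y * (C i * dist x y) := by
        refine (le_abs_self _).trans ?_
        rw [abs_mul]
        exact mul_le_mul ha hb (abs_nonneg _) hpos.le
      have hd' : n * dist x y ≤ 1 := by rw [← hd]; exact hx.2.le
      calc n * (dist x y)⁻¹ * ((y i - x i) * (F i x - F i y))
          ≤ n * (dist x y)⁻¹ * (dist x y * (C i * dist x y)) :=
            mul_le_mul_of_nonneg_left hc (by positivity)
        _ = (n * dist x y) * C i := by field_simp
        _ ≤ 1 * C i := mul_le_mul_of_nonneg_right hd' (C i).2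
        _ = C i := one_mul _
    simp_rw [h1]
    rw [Finset.sum_add_distrib, ← Finset.mul_sum Finset.univ (fun i => (y i - x i) * F i y)]
    have h3 : n * (dist x y)⁻¹ * ∑ i, (y i - x i) * F i y ≤ 0 :=
      mul_nonpos_of_nonneg_of_nonpos (by positivity) (hflux x hx.1 y hyf hball)
    have h4 := Finset.sum_le_sum fun i (_ : i ∈ Finset.univ) => h2 i
    linarith
  · rw [indicator_of_notMem hx, fderiv_cutoff_of_notMem_shell hn hx hdiff]
    simp

theorem integrable_of_bound_of_eq_zero {f : Space d → ℝ} {s : Set (Space d)} (hs : IsCompact s)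
    (hf : AEStronglyMeasurable f) {C : ℝ} (hC : ∀ x ∈ s, ‖f x‖ ≤ C) (h0 : ∀ x ∉ s, f x = 0) :
    Integrable f := by
  rw [← integrableOn_iff_integrable_of_support_subset (s := s)
    (fun x hx => by by_contra h; exact hx (h0 x h))]
  exact Measure.integrableOn_of_bounded (M := C) hs.measure_lt_top.ne hf
    (ae_restrict_of_forall_mem hs.measurableSet hC)

theorem integral_sum_lineDeriv_mul_cutoff_le (hΩ : IsOpen Ω) (hc : Ωᶜ.Nonempty)
    (hb : Bornology.IsBounded Ω) (hn : 0 < n)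
    {F : Fin d → Space d → ℝ} {C : Fin d → NNReal} (hF : ∀ i, LipschitzWith (C i) (F i))
    (hflux : ∀ x ∈ Ω, ∀ y ∈ frontier Ω, Metric.ball x (dist x y) ⊆ Ω →
      ∑ i, (y i - x i) * F i y ≤ 0) :
    ∫ x, ((∑ i, lineDeriv ℝ (F i) x (EuclideanSpace.single i 1)) * cutoff Ω n x -
      (shell Ω n).indicator (fun _ => ∑ i, (C i : ℝ)) x) ≤ 0 := by
  have hK := hb.isCompact_closure
  have hχ := lipschitzWith_cutoff (Ω := Ω) hn.le
  have hχ0 : ∀ x ∉ closure Ω, cutoff Ω n x = 0 := fun x hx =>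
    cutoff_eq_zero fun h => hx (subset_closure h)
  have hsupp : HasCompactSupport (cutoff Ω n) := HasCompactSupport.intro hK hχ0
  have hmeas : ∀ i, Measurable fun x => lineDeriv ℝ (F i) x (EuclideanSpace.single i (1 : ℝ)) :=
    fun i => measurable_lineDeriv (hF i).continuous
  have hmeas' : ∀ i, Measurable fun x =>
      lineDeriv ℝ (cutoff Ω n) x (-EuclideanSpace.single i (1 : ℝ)) :=
    fun i => measurable_lineDeriv hχ.continuous
  have hshell : MeasurableSet (shell Ω n) := measurableSet_shell hΩ
  have hbound : ∀ i x, ‖lineDeriv ℝ (F i) x (EuclideanSpace.single i (1 : ℝ))‖ ≤ C i := by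
    intro i x
    simpa using norm_lineDeriv_le_of_lipschitz ℝ (hF i) (x₀ := x)
      (v := EuclideanSpace.single i (1 : ℝ))
  have hint1 : ∀ i, Integrable fun x =>
      lineDeriv ℝ (F i) x (EuclideanSpace.single i (1 : ℝ)) * cutoff Ω n x := by
    intro i
    refine integrable_of_bound_of_eq_zero hK
      ((hmeas i).mul hχ.continuous.measurable).aestronglyMeasurable (C := C i) ?_ ?_
    · intro x _
      rw [norm_mul]
      calc _ ≤ (C i : ℝ) * 1 := by
            refine mul_le_mul (hbound i x) ?_ (norm_nonneg _) (C i).2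
            rw [Real.norm_of_nonneg (cutoff_nonneg hn.le)]
            exact cutoff_le_one
        _ = C i := mul_one _
    · intro x hx
      rw [hχ0 x hx, mul_zero]
  have hint2 : ∀ i, Integrable fun x =>
      lineDeriv ℝ (cutoff Ω n) x (-EuclideanSpace.single i (1 : ℝ)) * F i x := by
    intro i
    obtain ⟨B, hB⟩ := hK.exists_bound_of_continuousOn (hF i).continuous.continuousOn
    refine integrable_of_bound_of_eq_zero hK
      ((hmeas' i).mul (hF i).continuous.measurable).aestronglyMeasurable (C := n * B) ?_ ?_
    · intro x hx
      rw [norm_mul]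
      refine mul_le_mul ?_ (hB x hx) (norm_nonneg _) hn.le
      simpa [hn.le] using norm_lineDeriv_le_of_lipschitz ℝ hχ (x₀ := x)
        (v := -EuclideanSpace.single i (1 : ℝ))
    · intro x hx
      have : cutoff Ω n =ᶠ[𝓝 x] fun _ => 0 := by
        filter_upwards [isClosed_closure.isOpen_compl.mem_nhds hx] with z hz using hχ0 z hz
      rw [this.lineDeriv_eq]
      simp [lineDeriv]
  have hint3 : Integrable ((shell Ω n).indicator fun _ : Space d => ∑ i, (C i : ℝ)) := by
    refine (integrableOn_const ?_).integrable_indicator hshell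
    exact ((measure_mono fun x hx => subset_closure hx.1).trans_lt hK.measure_lt_top).ne
  have hint4 : Integrable fun x => (∑ i, lineDeriv ℝ (F i) x (EuclideanSpace.single i (1 : ℝ))) *
      cutoff Ω n x := by
    simp_rw [Finset.sum_mul]
    exact integrable_finsetSum _ fun i _ => hint1 i
  rw [integral_sub hint4 hint3, sub_nonpos]
  calc ∫ x, (∑ i, lineDeriv ℝ (F i) x (EuclideanSpace.single i (1 : ℝ))) * cutoff Ω n x
      = ∫ x, ∑ i, lineDeriv ℝ (cutoff Ω n) x (-EuclideanSpace.single i (1 : ℝ)) * F i x := by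
        simp_rw [Finset.sum_mul]
        rw [integral_finsetSum _ fun i _ => hint1 i, integral_finsetSum _ fun i _ => hint2 i]
        exact Finset.sum_congr rfl fun i _ => (hF i).integral_lineDeriv_mul_eq hχ hsupp _
    _ ≤ _ := by
        refine integral_mono_ae (integrable_finsetSum _ fun i _ => hint2 i) hint3 ?_
        filter_upwards [hχ.ae_differentiableAt] with x hx
        simp only [hx.lineDeriv_eq_fderiv]
        exact neg_sum_fderiv_cutoff_le hΩ hc hn hF hflux hx

end Cutoff

/-- The inequality `∫ div F ≤ 0` for a Lipschitz field on a bounded open set whose flux through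
the boundary is nonpositive; the flux condition is only needed at boundary points that are
touched by an interior ball. -/
theorem integral_sum_lineDeriv_nonpos {Ω : Set (Space d)} (hΩ : IsOpen Ω) (hc : Ωᶜ.Nonempty)
    (hb : Bornology.IsBounded Ω)
    {F : Fin d → Space d → ℝ} {C : Fin d → NNReal} (hF : ∀ i, LipschitzWith (C i) (F i))
    (hflux : ∀ x ∈ Ω, ∀ y ∈ frontier Ω, Metric.ball x (dist x y) ⊆ Ω →
      ∑ i, (y i - x i) * F i y ≤ 0) :
    ∫ x in Ω, ∑ i, lineDeriv ℝ (F i) x (EuclideanSpace.single i 1) ≤ 0 := by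
  set M : ℝ := ∑ i, (C i : ℝ) with hM
  have hM0 : 0 ≤ M := Finset.sum_nonneg fun i _ => (C i).2
  set G : Space d → ℝ := fun x => ∑ i, lineDeriv ℝ (F i) x (EuclideanSpace.single i 1) with hG
  have hGm : Measurable G :=
    Finset.measurable_sum _ fun i _ => measurable_lineDeriv (hF i).continuous
  have hGb : ∀ x, ‖G x‖ ≤ M := by
    intro x
    refine norm_sum_le_of_le _ fun i _ => ?_
    simpa using norm_lineDeriv_le_of_lipschitz ℝ (hF i) (x₀ := x)
      (v := EuclideanSpace.single i (1 : ℝ))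
  have hfin : volume Ω ≠ ⊤ :=
    ((measure_mono subset_closure).trans_lt hb.isCompact_closure.measure_lt_top).ne
  have hlim : Tendsto (fun n : ℕ => ∫ x in Ω, (G x * cutoff Ω (n + 1 : ℝ) x -
      (shell Ω (n + 1 : ℝ)).indicator (fun _ => M) x)) atTop (𝓝 (∫ x in Ω, G x)) := by
    refine tendsto_integral_of_dominated_convergence (fun _ => M + M) ?_ ?_ ?_ ?_
    · intro n
      exact ((hGm.mul (lipschitzWith_cutoff (by positivity)).continuous.measurable).sub
        (measurable_const.indicator (measurableSet_shell hΩ))).aestronglyMeasurable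
    · exact integrableOn_const hfin
    · intro n
      refine Eventually.of_forall fun x => (norm_sub_le _ _).trans (add_le_add ?_ ?_)
      · rw [norm_mul]
        calc _ ≤ M * 1 := by
              refine mul_le_mul (hGb x) ?_ (norm_nonneg _) hM0
              rw [Real.norm_of_nonneg (cutoff_nonneg (by positivity))]
              exact cutoff_le_one
          _ = M := mul_one _
      · refine (norm_indicator_le_norm_self _ _).trans ?_
        rw [Real.norm_of_nonneg hM0]
    · refine ae_restrict_of_forall_mem hΩ.measurableSet fun x hx => ?_
      have hpos := infDist_compl_pos hΩ hc hx
      refine tendsto_const_nhds.congr' ?_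
      obtain ⟨N, hN⟩ := exists_nat_gt (Metric.infDist x Ωᶜ)⁻¹
      filter_upwards [eventually_ge_atTop N] with n hn
      have h1 : 1 ≤ (n + 1 : ℝ) * Metric.infDist x Ωᶜ := by
        have : (N : ℝ) ≤ n := by exact_mod_cast hn
        rw [← div_le_iff₀ hpos, one_div]
        linarith
      rw [indicator_of_notMem fun h => (not_lt.2 h1) h.2, cutoff, min_eq_left h1]
      simp
  refine le_of_tendsto' hlim fun n => ?_
  have hle := integral_sum_lineDeriv_mul_cutoff_le hΩ hc hb (n := n + 1) (by positivity) hF hflux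
  rwa [setIntegral_eq_integral_of_forall_compl_eq_zero]
  intro x hx
  rw [cutoff_eq_zero hx, indicator_of_notMem fun h => hx h.1]
  simp

/-- The inequality `∫ div F ≤ 0` for a field that is `C¹` up to the boundary of a bounded open
convex set. -/
theorem integral_sum_pd_nonpos_of_convex {Ω : Set (Space d)} (hΩ : IsOpen Ω)
    (hb : Bornology.IsBounded Ω) (hconv : Convex ℝ Ω) {F : Fin d → Space d → ℝ}
    (hF : ∀ i, ContDiffOn ℝ 1 (F i) (closure Ω))
    (hflux : ∀ x ∈ Ω, ∀ y ∈ frontier Ω, Metric.ball x (dist x y) ⊆ Ω →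
      ∑ i, (y i - x i) * F i y ≤ 0) :
    ∫ x in Ω, ∑ i, pd (closure Ω) i (F i) x ≤ 0 := by
  rcases Nat.eq_zero_or_pos d with rfl | hd
  · simp
  have : Nonempty (Fin d) := ⟨⟨0, hd⟩⟩
  have hc : Ωᶜ.Nonempty := by
    rw [nonempty_compl]
    rintro rfl
    exact NormedSpace.unbounded_univ ℝ (Space d) hb
  have hlip : ∀ i, ∃ (C : NNReal) (G : Space d → ℝ),
      LipschitzWith C G ∧ EqOn (F i) G (closure Ω) := by
    intro i
    obtain ⟨C, hC⟩ := (hF i).locallyLipschitzOn hconv.closure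
      |>.exists_lipschitzOnWith_of_compact hb.isCompact_closure
    obtain ⟨G, hG⟩ := hC.extend_real
    exact ⟨C, G, hG⟩
  choose C G hG hFG using hlip
  have hkey := integral_sum_lineDeriv_nonpos hΩ hc hb hG ?_
  · refine le_of_eq_of_le (setIntegral_congr_fun hΩ.measurableSet fun x hx => ?_) hkey
    refine Finset.sum_congr rfl fun i _ => ?_
    have hnhds : closure Ω ∈ 𝓝 x := mem_of_superset (hΩ.mem_nhds hx) subset_closure
    have hloc : F i =ᶠ[𝓝 x] G i := by
      filter_upwards [hnhds] with z hz using hFG i hz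
    rw [pd_eq_fderiv hnhds, ← hloc.lineDeriv_eq, DifferentiableAt.lineDeriv_eq_fderiv]
    exact ((hF i).contDiffAt hnhds).differentiableAt (by simp)
  · intro x hx y hy hball
    have := hflux x hx y hy hball
    simpa only [fun i => hFG i (frontier_subset_closure hy)] using this

end

/-! ### The divergence theorem for periodic fields -/

section

variable {d : ℕ}

theorem integral_sum_pd_eq_zero_of_periodic {L : Fin d → ℝ} (hL : ∀ i, 0 < L i) (p : Fin d → ℝ)
    {F : Fin d → Space d → ℝ} (hF : ∀ i, ContDiff ℝ 1 (F i))
    (hper : ∀ i x, F i (x + EuclideanSpace.single i (L i)) = F i x) :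
    ∫ x in {x : Space d | ∀ i, x i ∈ Ioo (p i) (p i + L i)}, ∑ i, pd univ i (F i) x = 0 := by
  rcases d with _ | n
  · simp
  set e : (Fin (n + 1) → ℝ) ≃L[ℝ] Space (n + 1) := (EuclideanSpace.equiv (Fin (n + 1)) ℝ).symm
  have he : ⇑e = WithLp.toLp 2 := rfl
  have hmp : MeasurePreserving e := PiLp.volume_preserving_toLp (Fin (n + 1))
  have hemb : MeasurableEmbedding e := e.toHomeomorph.measurableEmbedding
  have hpre : e ⁻¹' {x : Space (n + 1) | ∀ i, x i ∈ Ioo (p i) (p i + L i)} =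
      univ.pi fun i => Ioo (p i) (p i + L i) := by
    ext y
    simp [he]
  rw [← hmp.setIntegral_preimage_emb hemb, hpre, volume_pi,
    setIntegral_congr_set Measure.univ_pi_Ioo_ae_eq_Icc, ← volume_pi]
  have hder : ∀ i y, HasFDerivAt (fun y => F i (e y))
      ((fderiv ℝ (F i) (e y)).comp (e : (Fin (n + 1) → ℝ) →L[ℝ] Space (n + 1))) y := fun i y =>
    ((hF i).differentiable (by simp) (e y)).hasFDerivAt.comp y e.hasFDerivAt
  have hcont : ∀ i, Continuous fun y => F i (e y) := fun i => (hF i).continuous.comp e.continuous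
  have hsum : ∀ y, ∑ i, pd univ i (F i) (e y) = ∑ i, ((fderiv ℝ (F i) (e y)).comp
      (e : (Fin (n + 1) → ℝ) →L[ℝ] Space (n + 1))) (Pi.single i 1) := by
    intro y
    refine Finset.sum_congr rfl fun i _ => ?_
    rw [pd, fderivWithin_univ]
    rfl
  simp_rw [hsum]
  rw [integral_divergence_of_hasFDerivAt_off_countable' p (fun i => p i + L i)
    (fun i => by simpa using (hL i).le) (fun i y => F i (e y)) _ ∅ countable_empty
    (fun i => (hcont i).continuousOn) (fun y _ i => hder i y)]
  · refine Finset.sum_eq_zero fun i _ => sub_eq_zero.2 ?_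
    congr 1
    ext y
    refine Eq.trans (congrArg (F i) ?_) (hper i _)
    ext j
    refine Fin.succAboveCases i ?_ (fun k => ?_) j
    · simp [he]
    · simp [he, (Fin.succAbove_ne i k)]
  · refine Continuous.integrableOn_Icc ?_
    refine continuous_finsetSum _ fun i _ => ?_
    exact (((hF i).continuous_fderiv (by simp)).comp e.continuous).clm_apply
      continuous_const

end

/-! ### Normals of convex sets with smooth boundary -/

section

variable {d : ℕ}

/-- A defining function that is only required to be differentiable at the boundary point. A
smooth defining function at `p` need not be smooth at boundary points near `p`, but it is a
defining function in this weaker sense there. -/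
structure IsWeakDefiningFunction (Ω : Set (Space d)) (p : Space d) (φ : Space d → ℝ) : Prop where
  differentiableAt : DifferentiableAt ℝ φ p
  zero : φ p = 0
  mem_iff : ∀ᶠ x in 𝓝 p, x ∈ Ω ↔ φ x < 0

section Normals

variable {Ω : Set (Space d)} {p v : Space d} {φ ψ : Space d → ℝ}

theorem IsLocalDefiningFunction.weak (h : IsLocalDefiningFunction Ω p φ) :
    IsWeakDefiningFunction Ω p φ :=
  ⟨h.smooth.differentiableAt (by simp), h.zero, h.mem_iff⟩

theorem tendsto_add_smul_nhdsGT (p v : Space d) :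
    Tendsto (fun t : ℝ => p + t • v) (𝓝[>] 0) (𝓝 p) := by
  have : Continuous fun t : ℝ => p + t • v := by fun_prop
  have h := this.tendsto 0
  simp only [zero_smul, add_zero] at h
  exact h.mono_left nhdsWithin_le_nhds

theorem tendsto_slope_gradient (h : DifferentiableAt ℝ φ p) (h0 : φ p = 0) (v : Space d) :
    Tendsto (fun t : ℝ => t⁻¹ * φ (p + t • v)) (𝓝[>] 0) (𝓝 (inner ℝ (gradient φ p) v)) := by
  have h1 := (h.hasFDerivAt.hasLineDerivAt v).tendsto_slope_zero_right
  rw [gradient, InnerProductSpace.toDual_symm_apply]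
  simpa [h0] using h1

theorem IsWeakDefiningFunction.inner_nonpos (h : IsWeakDefiningFunction Ω p φ)
    (hv : ∀ᶠ t : ℝ in 𝓝[>] 0, p + t • v ∈ Ω) : inner ℝ (gradient φ p) v ≤ 0 := by
  refine le_of_tendsto (tendsto_slope_gradient h.differentiableAt h.zero v) ?_
  filter_upwards [hv, (tendsto_add_smul_nhdsGT p v).eventually h.mem_iff, self_mem_nhdsWithin]
    with t ht hiff ht0
  have h1 : φ (p + t • v) < 0 := hiff.1 ht
  exact (mul_neg_of_pos_of_neg (inv_pos.2 ht0) h1).le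

theorem IsWeakDefiningFunction.eventually_mem (h : IsWeakDefiningFunction Ω p φ)
    (hv : inner ℝ (gradient φ p) v < 0) : ∀ᶠ t : ℝ in 𝓝[>] 0, p + t • v ∈ Ω := by
  filter_upwards [(tendsto_slope_gradient h.differentiableAt h.zero v).eventually_lt_const hv,
    (tendsto_add_smul_nhdsGT p v).eventually h.mem_iff, self_mem_nhdsWithin] with t ht hiff ht0
  rw [hiff]
  exact (pos_iff_neg_of_mul_neg ht).1 (inv_pos.2 ht0)

theorem IsWeakDefiningFunction.eventually_notMem (h : IsWeakDefiningFunction Ω p φ)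
    (hv : 0 < inner ℝ (gradient φ p) v) : ∀ᶠ t : ℝ in 𝓝[>] 0, p + t • v ∉ Ω := by
  filter_upwards [(tendsto_slope_gradient h.differentiableAt h.zero v).eventually_const_lt hv,
    (tendsto_add_smul_nhdsGT p v).eventually h.mem_iff, self_mem_nhdsWithin] with t ht hiff ht0
  rw [hiff, not_lt]
  exact ((mul_pos_iff_of_pos_left (inv_pos.2 ht0)).1 ht).le

/-- Two vectors whose half-spaces are nested have the same direction. -/
theorem norm_smul_eq_of_halfSpace_subset {N M : Space d}
    (h : ∀ v, inner ℝ N v < 0 → inner ℝ M v ≤ 0) : ‖N‖ • M = ‖M‖ • N := by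
  rw [← inner_eq_norm_mul_iff_real]
  by_contra hne
  have hlt : inner ℝ M N < ‖M‖ * ‖N‖ := lt_of_le_of_ne (real_inner_le_norm M N) hne
  have hN : 0 < ‖N‖ := by
    rcases (norm_nonneg N).eq_or_lt with h0 | h0
    · simp [norm_eq_zero.1 h0.symm] at hne
    · exact h0
  have hM : 0 < ‖M‖ := by
    rcases (norm_nonneg M).eq_or_lt with h0 | h0
    · simp [norm_eq_zero.1 h0.symm] at hne
    · exact h0
  have key := h (‖N‖ • M - ‖M‖ • N) ?_
  · rw [inner_sub_right, inner_smul_right, inner_smul_right, real_inner_self_eq_norm_sq] at key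
    nlinarith
  · rw [inner_sub_right, inner_smul_right, inner_smul_right, real_inner_self_eq_norm_sq,
      real_inner_comm]
    nlinarith

theorem IsWeakDefiningFunction.gradient_parallel (h : IsWeakDefiningFunction Ω p φ)
    (h' : IsWeakDefiningFunction Ω p ψ) :
    ‖gradient φ p‖ • gradient ψ p = ‖gradient ψ p‖ • gradient φ p :=
  norm_smul_eq_of_halfSpace_subset fun _ hv => h'.inner_nonpos (h.eventually_mem hv)

/-- The radius of an interior ball to a touching boundary point is normal to the boundary. -/
theorem IsWeakDefiningFunction.radius_parallel (h : IsWeakDefiningFunction Ω p φ) {x : Space d}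
    (hball : Metric.ball x (dist x p) ⊆ Ω) :
    ‖p - x‖ • gradient φ p = ‖gradient φ p‖ • (p - x) := by
  refine norm_smul_eq_of_halfSpace_subset fun v hv => h.inner_nonpos ?_
  have hlim : Tendsto (fun t : ℝ => 2 * inner ℝ (p - x) v + t * ‖v‖ ^ 2) (𝓝[>] 0)
      (𝓝 (2 * inner ℝ (p - x) v)) := by
    have : Continuous fun t : ℝ => 2 * inner ℝ (p - x) v + t * ‖v‖ ^ 2 := by fun_prop
    have h := this.tendsto 0
    simp only [zero_mul, add_zero] at h
    exact h.mono_left nhdsWithin_le_nhds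
  filter_upwards [hlim.eventually_lt_const (show 2 * inner ℝ (p - x) v < 0 by linarith),
    self_mem_nhdsWithin] with t ht ht0
  refine hball ?_
  have ht0' : (0 : ℝ) < t := ht0
  rw [Metric.mem_ball, dist_comm x p, dist_eq_norm, dist_eq_norm,
    show p + t • v - x = (p - x) + t • v by abel]
  refine lt_of_pow_lt_pow_left₀ 2 (norm_nonneg _) ?_
  rw [norm_add_sq_real, inner_smul_right, norm_smul, Real.norm_of_nonneg ht0'.le]
  nlinarith

theorem IsWeakDefiningFunction.inner_sub_nonpos (h : IsWeakDefiningFunction Ω p φ)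
    (hΩ : IsOpen Ω) (hconv : Convex ℝ Ω) (hp : p ∈ closure Ω) {z : Space d} (hz : z ∈ closure Ω) :
    inner ℝ (gradient φ p) (z - p) ≤ 0 := by
  have hin : ∀ z ∈ Ω, inner ℝ (gradient φ p) (z - p) ≤ 0 := by
    intro z hz
    refine h.inner_nonpos ?_
    filter_upwards [Ioo_mem_nhdsGT one_pos] with t ht
    have := hconv.openSegment_interior_closure_subset_interior (hΩ.interior_eq.symm ▸ hz) hp
    refine interior_subset (this ⟨t, 1 - t, ht.1, by linarith [ht.2], by ring, ?_⟩)
    rw [smul_sub, sub_smul, one_smul]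
    abel
  refine closure_minimal (t := {z | inner ℝ (gradient φ p) (z - p) ≤ 0}) hin ?_ hz
  exact isClosed_le (by fun_prop) continuous_const

theorem exists_mem_segment_frontier (hΩ : IsOpen Ω) {x y : Space d} (hx : x ∈ Ω) (hy : y ∉ Ω) :
    ∃ z ∈ segment ℝ x y, z ∈ frontier Ω := by
  by_contra hno
  push Not at hno
  have hpre : IsPreconnected (segment ℝ x y) := (convex_segment x y).isPreconnected
  have hcov : segment ℝ x y ⊆ Ω ∪ (closure Ω)ᶜ := by
    intro z hz
    by_cases hzΩ : z ∈ Ω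
    · exact Or.inl hzΩ
    · refine Or.inr fun hzc => hno z hz ?_
      rw [frontier, hΩ.interior_eq]
      exact ⟨hzc, hzΩ⟩
  rcases isPreconnected_iff_subset_of_disjoint.1 hpre Ω (closure Ω)ᶜ hΩ
    isClosed_closure.isOpen_compl hcov (by
      rw [(disjoint_compl_right.mono_left subset_closure :
        Disjoint Ω (closure Ω)ᶜ).inter_eq, inter_empty]) with h | h
  · exact hy (h (right_mem_segment ℝ x y))
  · exact h (left_mem_segment ℝ x y) (subset_closure hx)

/-- Every tangential direction `τ` at a boundary point is the limit of directions to boundary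
points. -/
theorem IsLocalDefiningFunction.exists_frontier_near (h : IsLocalDefiningFunction Ω p φ)
    (hΩ : IsOpen Ω) {τ : Space d} (hτ : inner ℝ (gradient φ p) τ = 0) {ε : ℝ} (hε : 0 < ε) :
    ∃ t : ℝ, 0 < t ∧ t < ε ∧ ∃ γ ∈ frontier Ω, ‖γ - p - t • τ‖ ≤ ε * t := by
  set N := gradient φ p with hN
  have hNpos : 0 < ‖N‖ := norm_pos_iff.2 h.gradient_ne_zero
  set m : Space d := ‖N‖⁻¹ • N with hm
  have hmnorm : ‖m‖ = 1 := by
    rw [hm, norm_smul, norm_inv, norm_norm, inv_mul_cancel₀ hNpos.ne']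
  have hNm : inner ℝ N m = ‖N‖ := by
    rw [hm, inner_smul_right, real_inner_self_eq_norm_sq]
    field_simp
  have h1 := h.weak.eventually_mem (v := τ - ε • m) (by
    rw [← hN, inner_sub_right, inner_smul_right, hτ, hNm]
    nlinarith)
  have h2 := h.weak.eventually_notMem (v := τ + ε • m) (by
    rw [← hN, inner_add_right, inner_smul_right, hτ, hNm]
    nlinarith)
  obtain ⟨t, ht1, ht2, ht⟩ := (h1.and (h2.and (Ioo_mem_nhdsGT hε))).exists
  obtain ⟨γ, hγ, hγf⟩ := exists_mem_segment_frontier hΩ ht1 ht2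
  refine ⟨t, ht.1, ht.2, γ, hγf, ?_⟩
  have hsub : segment ℝ (p + t • (τ - ε • m)) (p + t • (τ + ε • m)) ⊆
      Metric.closedBall (p + t • τ) (ε * t) := by
    refine (convex_closedBall _ _).segment_subset ?_ ?_
    · rw [mem_closedBall_iff_norm, show p + t • (τ - ε • m) - (p + t • τ) = -(t * ε) • m by
        rw [neg_smul, mul_smul, smul_sub]; abel, norm_smul, hmnorm, norm_neg,
        Real.norm_of_nonneg (mul_pos ht.1 hε).le]
      linarith
    · rw [mem_closedBall_iff_norm, show p + t • (τ + ε • m) - (p + t • τ) = (t * ε) • m by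
        rw [mul_smul, smul_add]; abel, norm_smul, hmnorm,
        Real.norm_of_nonneg (mul_pos ht.1 hε).le]
      linarith
  have := hsub hγ
  rwa [mem_closedBall_iff_norm, ← sub_sub] at this

/-- If a vector field is tangential along the boundary of a convex set, its derivative in its own
direction does not point outwards. Differentiating the tangency condition along the boundary
would bring in the second fundamental form; here its sign is replaced by the
monotonicity `⟨N(p) - N(γ), γ - p⟩ ≤ 0` of the normals, which needs no parametrization of the
boundary. -/
theorem IsLocalDefiningFunction.inner_fderivWithin_nonpos (h : IsLocalDefiningFunction Ω p φ)
    (hΩ : IsOpen Ω) (hconv : Convex ℝ Ω) (hsmooth : HasSmoothBoundary Ω) (hp : p ∈ frontier Ω)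
    {V : Space d → Space d} (hV : DifferentiableWithinAt ℝ V (closure Ω) p)
    (htan : ∀ q ∈ frontier Ω, ∀ ν, IsOuterUnitNormal Ω q ν → inner ℝ ν (V q) = 0) :
    inner ℝ (gradient φ p) (fderivWithin ℝ V (closure Ω) p (V p)) ≤ 0 := by
  -- tangency in terms of the gradient of a defining function
  have htan' : ∀ q ∈ frontier Ω, ∀ χ, IsWeakDefiningFunction Ω q χ →
      inner ℝ (gradient χ q) (V q) = 0 := by
    intro q hq χ hχ
    obtain ⟨ψ, hψ⟩ := hsmooth q hq
    have hpar := hψ.weak.gradient_parallel hχ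
    have h1 := htan q hq _ ⟨ψ, hψ, rfl⟩
    rw [inner_smul_left] at h1
    have h2 : inner ℝ (gradient ψ q) (V q) = 0 := by
      exact (mul_eq_zero.1 h1).resolve_left (by simpa using hψ.gradient_ne_zero)
    have h3 := congrArg (fun z => inner ℝ z (V q)) hpar
    simp only [inner_smul_left] at h3
    rw [h2, mul_zero] at h3
    exact (mul_eq_zero.1 h3).resolve_left (by simpa using hψ.gradient_ne_zero)
  -- `φ` is a weak defining function at the boundary points near `p`
  have hweak : ∀ᶠ q in 𝓝 p, q ∈ frontier Ω → IsWeakDefiningFunction Ω q φ := by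
    have hd1 : ∀ᶠ q in 𝓝 p, DifferentiableAt ℝ φ q :=
      ((h.smooth.of_le (m := 1) (by norm_cast)).eventually (by simp)).mono
        fun q hq => hq.differentiableAt (by simp)
    filter_upwards [hd1, h.mem_iff.eventually_nhds] with q hq1 hq2 hqf
    rw [frontier, hΩ.interior_eq] at hqf
    refine ⟨hq1, le_antisymm ?_ ?_, hq2⟩
    · have hfr : ∃ᶠ x in 𝓝 q, φ x ≤ 0 := by
        refine ((mem_closure_iff_frequently.1 hqf.1).and_eventually hq2).mono fun x hx => ?_
        exact (hx.2.1 hx.1).le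
      by_contra hpos
      push Not at hpos
      exact hfr ((hq1.continuousAt.eventually_const_lt hpos).mono fun x hx => not_le.2 hx)
    · by_contra hneg
      push Not at hneg
      exact hqf.2 (hq2.self_of_nhds.2 hneg)
  set τ := V p with hτ
  have hτ0 : inner ℝ (gradient φ p) τ = 0 := htan' p hp φ h.weak
  choose t ht0 htlt γ hγf hγ using fun n : ℕ =>
    h.exists_frontier_near hΩ hτ0 (ε := 1 / ((n : ℝ) + 1)) (by positivity)
  have hε : Tendsto (fun n : ℕ => 1 / ((n : ℝ) + 1)) atTop (𝓝 0) :=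
    tendsto_one_div_add_atTop_nhds_zero_nat
  have ht : Tendsto t atTop (𝓝 0) :=
    squeeze_zero (fun n => (ht0 n).le) (fun n => (htlt n).le) hε
  have hdir : Tendsto (fun n => (t n)⁻¹ • (γ n - p)) atTop (𝓝 τ) := by
    rw [tendsto_iff_norm_sub_tendsto_zero]
    refine squeeze_zero (fun n => norm_nonneg _) (fun n => ?_) hε
    have h1 : (t n)⁻¹ • (γ n - p) - τ = (t n)⁻¹ • (γ n - p - t n • τ) := by
      rw [smul_sub _ (γ n - p), smul_smul, inv_mul_cancel₀ (ht0 n).ne', one_smul]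
    rw [h1, norm_smul, Real.norm_of_nonneg (inv_pos.2 (ht0 n)).le, inv_mul_le_iff₀ (ht0 n),
      mul_comm]
    exact hγ n
  have hγp : Tendsto γ atTop (𝓝 p) := by
    have h1 : Tendsto (fun n => p + t n • ((t n)⁻¹ • (γ n - p))) atTop (𝓝 (p + (0 : ℝ) • τ)) :=
      tendsto_const_nhds.add (ht.smul hdir)
    simp only [zero_smul, add_zero] at h1
    refine h1.congr fun n => ?_
    rw [smul_smul, mul_inv_cancel₀ (ht0 n).ne', one_smul]
    abel
  have hVlim : Tendsto (fun n => (t n)⁻¹ • (V (γ n) - V p)) atTop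
      (𝓝 (fderivWithin ℝ V (closure Ω) p τ)) := by
    have h1 := hV.hasFDerivWithinAt.lim (c := fun n => (t n)⁻¹) (d := fun n => γ n - p)
      (by simpa using hγp.sub_const p)
      (Eventually.of_forall fun n => by
        simpa using frontier_subset_closure (hγf n)) hdir
    simpa using h1
  have hNdiff : DifferentiableAt ℝ (gradient φ) p := by
    have h1 : ContDiffAt ℝ 1 (fderiv ℝ φ) p :=
      h.smooth.fderiv_right (m := 1) (by norm_cast)
    exact (InnerProductSpace.toDual ℝ (Space d)).symm.toContinuousLinearEquiv.differentiableAt.comp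
      p (h1.differentiableAt (by simp))
  have hNlim : Tendsto (fun n => (t n)⁻¹ • (gradient φ (γ n) - gradient φ p)) atTop
      (𝓝 (fderiv ℝ (gradient φ) p τ)) := by
    have h1 := hNdiff.hasFDerivAt.hasFDerivWithinAt (s := univ) |>.lim
      (c := fun n => (t n)⁻¹) (d := fun n => γ n - p)
      (by simpa using hγp.sub_const p) (Eventually.of_forall fun n => mem_univ _) hdir
    simpa using h1
  have hVγ : Tendsto (fun n => V (γ n)) atTop (𝓝 τ) := by
    have h1 : Tendsto (fun n => V p + t n • ((t n)⁻¹ • (V (γ n) - V p))) atTop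
        (𝓝 (V p + (0 : ℝ) • fderivWithin ℝ V (closure Ω) p τ)) :=
      tendsto_const_nhds.add (ht.smul hVlim)
    simp only [zero_smul, add_zero] at h1
    refine h1.congr fun n => ?_
    rw [smul_smul, mul_inv_cancel₀ (ht0 n).ne', one_smul]
    abel
  have hlhs : Tendsto (fun n => inner ℝ (gradient φ p) ((t n)⁻¹ • (V (γ n) - V p))) atTop
      (𝓝 (inner ℝ (gradient φ p) (fderivWithin ℝ V (closure Ω) p τ))) :=
    tendsto_const_nhds.inner hVlim
  have hrhs : Tendsto (fun n => -inner ℝ ((t n)⁻¹ • (gradient φ (γ n) - gradient φ p))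
      (V (γ n) - (t n)⁻¹ • (γ n - p))) atTop (𝓝 0) := by
    have := (hNlim.inner (𝕜 := ℝ) (hVγ.sub hdir)).neg
    simpa using this
  refine le_of_tendsto_of_tendsto hlhs hrhs ?_
  filter_upwards [hγp.eventually hweak] with n hn
  have hw := hn (hγf n)
  have hm1 := h.weak.inner_sub_nonpos hΩ hconv (frontier_subset_closure hp)
    (frontier_subset_closure (hγf n))
  have hm2 := hw.inner_sub_nonpos hΩ hconv (frontier_subset_closure (hγf n))
    (frontier_subset_closure hp)
  have hz := htan' (γ n) (hγf n) φ hw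
  have hti : 0 < (t n)⁻¹ := inv_pos.2 (ht0 n)
  simp only [inner_smul_left, inner_smul_right, inner_sub_left, inner_sub_right, hz,
    RCLike.conj_to_real] at hm1 hm2 ⊢
  have : 0 ≤ (t n)⁻¹ * (t n)⁻¹ := by positivity
  nlinarith

end Normals

end

/-! ### Integration by parts -/

section

variable {d : ℕ} {bc : BoundaryCondition d} {Ω : Set (Space d)}

/-- The inequality `∫ div F ≤ 0` for fields with nonpositive boundary flux (Neumann case) or
periodic fields. -/
theorem BoundaryCondition.IsDomain.integral_sum_pd_nonpos (hΩ : bc.IsDomain Ω)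
    {F : Fin d → Space d → ℝ} (hF : ∀ i, ContDiffOn ℝ 1 (F i) (bc.region Ω))
    (hinv : ∀ i, bc.Invariant (F i))
    (hflux : bc = .neumann → ∀ p ∈ frontier Ω, ∀ φ, IsLocalDefiningFunction Ω p φ →
      ∑ i, gradient φ p i * F i p ≤ 0) :
    ∫ x in Ω, ∑ i, pd (bc.region Ω) i (F i) x ≤ 0 := by
  cases bc with
  | neumann =>
    refine integral_sum_pd_nonpos_of_convex hΩ.isOpen hΩ.2.2.1 hΩ.convex hF ?_
    intro x hx p hp hball
    obtain ⟨φ, hφ⟩ := hΩ.2.2.2.2 p hp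
    have hpar := hφ.weak.radius_parallel hball
    have hpos : 0 < ‖gradient φ p‖ := norm_pos_iff.2 hφ.gradient_ne_zero
    have h1 : ‖gradient φ p‖ * ∑ i, (p i - x i) * F i p =
        ‖p - x‖ * ∑ i, gradient φ p i * F i p := by
      rw [Finset.mul_sum, Finset.mul_sum]
      refine Finset.sum_congr rfl fun i _ => ?_
      have := congrArg (fun v : Space d => v i) hpar
      simp only [PiLp.smul_apply, PiLp.sub_apply, smul_eq_mul] at this
      rw [← mul_assoc, ← mul_assoc, this]
    have h2 := mul_nonpos_of_nonneg_of_nonpos (norm_nonneg (p - x)) (hflux rfl p hp φ hφ)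
    rw [← h1] at h2
    exact nonpos_of_mul_nonpos_right h2 hpos
  | periodic L =>
    obtain ⟨hL, p, rfl⟩ := hΩ
    exact (integral_sum_pd_eq_zero_of_periodic hL p (fun i => contDiffOn_univ.1 (hF i))
      fun i x => hinv i i x).le

/-- The gradient of `f` as a vector field, relative to the set `D`. -/
def grad (D : Set (Space d)) (f : Space d → ℝ) (x : Space d) : Space d :=
  WithLp.toLp 2 fun i => pd D i f x

theorem sum_gradient_mul_pd_eq_zero {f : Space d → ℝ}
    (hf : BoundaryCondition.Holds .neumann Ω f) {p : Space d} (hp : p ∈ frontier Ω)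
    {φ : Space d → ℝ} (hφ : IsLocalDefiningFunction Ω p φ) :
    ∑ i, gradient φ p i * pd (closure Ω) i f p = 0 := by
  have h := hf p hp _ ⟨φ, hφ, rfl⟩
  rw [map_smul, smul_eq_mul, fderivWithin_apply_eq_sum_pd] at h
  exact (mul_eq_zero.1 h).resolve_left (by simpa using hφ.gradient_ne_zero)

theorem BoundaryCondition.IsDomain.integral_sum_pd_mul_pd (hΩ : bc.IsDomain Ω)
    {f g : Space d → ℝ} (hf : ContDiffOn ℝ ∞ f (bc.region Ω)) (hfbc : bc.Holds Ω f)
    (hg : ContDiffOn ℝ 1 g (bc.region Ω)) (hginv : bc.Invariant g) :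
    ∫ x in Ω, ∑ i, pd (bc.region Ω) i (fun y => g y * pd (bc.region Ω) i f y) x = 0 := by
  have hle : ∀ g : Space d → ℝ, ContDiffOn ℝ 1 g (bc.region Ω) → bc.Invariant g →
      ∫ x in Ω, ∑ i, pd (bc.region Ω) i (fun y => g y * pd (bc.region Ω) i f y) x ≤ 0 := by
    intro g hg hginv
    refine hΩ.integral_sum_pd_nonpos
      (fun i => hg.mul ((contDiffOn_pd hΩ.uniqueDiffOn hf i).of_le (by norm_cast)))
      (fun i => hginv.mul (hfbc.invariant.pd i)) ?_
    rintro rfl p hp φ hφ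
    refine le_of_eq ?_
    have := sum_gradient_mul_pd_eq_zero hfbc hp hφ
    calc _ = g p * ∑ i, gradient φ p i * pd (closure Ω) i f p := by
          rw [Finset.mul_sum]
          exact Finset.sum_congr rfl fun i _ => by
            simp only [BoundaryCondition.region]; ring
      _ = 0 := by rw [this, mul_zero]
  refine le_antisymm (hle g hg hginv) ?_
  have h := hle (fun x => -1 * g x) (contDiffOn_const.mul hg) (hginv.comp fun y => -1 * y)
  have hD := hΩ.uniqueDiffOn
  have hneg : ∀ x ∈ Ω,
      ∑ i, pd (bc.region Ω) i (fun y => -1 * g y * pd (bc.region Ω) i f y) x =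
        -∑ i, pd (bc.region Ω) i (fun y => g y * pd (bc.region Ω) i f y) x := by
    intro x hx
    rw [← Finset.sum_neg_distrib]
    refine Finset.sum_congr rfl fun i _ => ?_
    simp_rw [mul_assoc]
    rw [pd_const_mul hD (bc.subset_region Ω hx)]
    · ring
    · exact (hg.differentiableOn (by simp)).mul
        ((contDiffOn_pd hD hf i).differentiableOn (by simp))
  rw [setIntegral_congr_fun hΩ.isOpen.measurableSet hneg, integral_neg] at h
  linarith

theorem BoundaryCondition.IsDomain.flux_hessian_nonpos (hΩ : BoundaryCondition.neumann.IsDomain Ω)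
    {w : Space d → ℝ} (hw : ContDiffOn ℝ ∞ w (closure Ω))
    (hwbc : BoundaryCondition.Holds .neumann Ω w)
    {p : Space d} (hp : p ∈ frontier Ω) {φ : Space d → ℝ} (hφ : IsLocalDefiningFunction Ω p φ) :
    ∑ i, gradient φ p i *
      ∑ j, pd (closure Ω) j (pd (closure Ω) i w) p * pd (closure Ω) j w p ≤ 0 := by
  have hD : UniqueDiffOn ℝ (closure Ω) := hΩ.uniqueDiffOn
  have hpc := frontier_subset_closure hp
  have hcomp : ∀ i, DifferentiableWithinAt ℝ (pd (closure Ω) i w) (closure Ω) p := fun i =>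
    (contDiffOn_pd hD hw i).differentiableOn (by simp) p hpc
  have hV : HasFDerivWithinAt (grad (closure Ω) w)
      ((EuclideanSpace.equiv (Fin d) ℝ).symm.toContinuousLinearMap.comp
        (ContinuousLinearMap.pi fun i => fderivWithin ℝ (pd (closure Ω) i w) (closure Ω) p))
      (closure Ω) p :=
    (EuclideanSpace.equiv (Fin d) ℝ).symm.hasFDerivAt.comp_hasFDerivWithinAt p
      (hasFDerivWithinAt_pi.2 fun i => (hcomp i).hasFDerivWithinAt)
  have key := hφ.inner_fderivWithin_nonpos hΩ.isOpen hΩ.convex hΩ.2.2.2.2 hp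
    hV.differentiableWithinAt ?_
  · rw [hV.fderivWithin (hD p hpc), PiLp.inner_apply] at key
    refine le_of_eq_of_le (Finset.sum_congr rfl fun i _ => ?_) key
    simp [fderivWithin_apply_eq_sum_pd, grad, mul_comm]
  · intro q hq ν hν
    have h := hwbc q hq ν hν
    rw [fderivWithin_apply_eq_sum_pd] at h
    rw [PiLp.inner_apply, ← h]
    simp [grad, mul_comm]

/-- The integrated Bochner inequality: for a nonnegative weight `β`, the integral of
`div (β (∇²w ∇w - Δw ∇w))` is nonpositive. In the Neumann case the sign comes from
the convexity of the domain. -/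
theorem BoundaryCondition.IsDomain.integral_sum_pd_hessian_nonpos (hΩ : bc.IsDomain Ω)
    {w β : Space d → ℝ} (hw : ContDiffOn ℝ ∞ w (bc.region Ω)) (hwbc : bc.Holds Ω w)
    (hβ : ContDiffOn ℝ 1 β (bc.region Ω)) (hβinv : bc.Invariant β)
    (hβ0 : ∀ x ∈ bc.region Ω, 0 ≤ β x) :
    ∫ x in Ω, ∑ i, pd (bc.region Ω) i (fun y => β y *
      ((∑ j, pd (bc.region Ω) j (pd (bc.region Ω) i w) y * pd (bc.region Ω) j w y) -
        (∑ j, pd (bc.region Ω) j (pd (bc.region Ω) j w) y) * pd (bc.region Ω) i w y)) x ≤ 0 := by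
  have hD := hΩ.uniqueDiffOn
  have h1 := fun i => contDiffOn_pd hD hw i
  have h2 := fun i j => contDiffOn_pd hD (h1 i) j
  have hle : ∀ {f : Space d → ℝ}, ContDiffOn ℝ ∞ f (bc.region Ω) →
      ContDiffOn ℝ 1 f (bc.region Ω) := fun hf => hf.of_le (by norm_cast)
  have i1 := fun i => hwbc.invariant.pd (Ω := Ω) i
  have i2 := fun i j => (i1 i).pd (Ω := Ω) j
  refine hΩ.integral_sum_pd_nonpos (fun i => hβ.mul (hle ((ContDiffOn.sum fun j _ =>
    (h2 i j).mul (h1 j)).sub ((ContDiffOn.sum fun j _ => h2 j j).mul (h1 i)))))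
    (fun i => hβinv.mul ((BoundaryCondition.Invariant.sum fun j => (i2 i j).mul (i1 j)).sub
      ((BoundaryCondition.Invariant.sum fun j => i2 j j).mul (i1 i)))) ?_
  rintro rfl p hp φ hφ
  simp only [BoundaryCondition.region]
  have e1 := sum_gradient_mul_pd_eq_zero hwbc hp hφ
  have e2 := hΩ.flux_hessian_nonpos hw hwbc hp hφ
  set Δ := ∑ j, pd (closure Ω) j (pd (closure Ω) j w) p
  calc _ = β p * (∑ i, gradient φ p i *
          ∑ j, pd (closure Ω) j (pd (closure Ω) i w) p * pd (closure Ω) j w p) -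
        β p * Δ * ∑ i, gradient φ p i * pd (closure Ω) i w p := by
        rw [Finset.mul_sum, Finset.mul_sum, ← Finset.sum_sub_distrib]
        exact Finset.sum_congr rfl fun i _ => by ring
    _ ≤ 0 := by
        rw [e1, mul_zero, sub_zero]
        exact mul_nonpos_of_nonneg_of_nonpos (hβ0 p (frontier_subset_closure hp)) e2

end

/-! ### The structure functions -/

section

variable {d : ℕ} {bc : BoundaryCondition d} {Ω : Set (Space d)}

theorem bFun_hasDerivAt_and_contDiffAt {C u₀ u : ℝ} {μ h : ℝ → ℝ} (hμ : ContDiffAt ℝ ∞ μ u)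
    (hh : ContDiffAt ℝ ∞ h u)
    (hint : IntervalIntegrable (fun v => μ v * deriv μ v * deriv (deriv h) v) volume u₀ u) :
    HasDerivAt (bFun C μ h u₀) (2 / 3 * (C + 2) * (μ u * deriv μ u * deriv (deriv h) u)) u ∧
      ContDiffAt ℝ 1 (bFun C μ h u₀) u := by
  set f : ℝ → ℝ := fun v => μ v * deriv μ v * deriv (deriv h) v with hf
  have hfs : ContDiffAt ℝ 1 f u := ((hμ.mul (contDiffAt_infty_deriv hμ)).mul
    (contDiffAt_infty_deriv (contDiffAt_infty_deriv hh))).of_le (by norm_cast)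
  obtain ⟨r, hr, hball⟩ := Metric.eventually_nhds_iff_ball.1 (hfs.eventually (by simp))
  have hcont : ContinuousOn f (Metric.ball u r) := fun z hz =>
    (hball z hz).continuousAt.continuousWithinAt
  have hder : ∀ z ∈ Metric.ball u r,
      HasDerivAt (bFun C μ h u₀) (2 / 3 * (C + 2) * f z) z := by
    intro z hz
    have hsub : uIcc u z ⊆ Metric.ball u r := by
      rw [← segment_eq_uIcc]
      exact (convex_ball u r).segment_subset (Metric.mem_ball_self hr) hz
    have hint' : IntervalIntegrable f volume u₀ z :=
      hint.trans ((hcont.mono hsub).intervalIntegrable)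
    exact (intervalIntegral.integral_hasDerivAt_right hint'
      (hcont.stronglyMeasurableAtFilter Metric.isOpen_ball z hz)
      (hball z hz).continuousAt).const_mul _
  refine ⟨hder u (Metric.mem_ball_self hr), ?_⟩
  refine contDiffAt_one_iff.2 ⟨fun z => ContinuousLinearMap.toSpanSingleton ℝ
    (2 / 3 * (C + 2) * f z), Metric.ball u r, Metric.ball_mem_nhds u hr, ?_, fun z hz =>
      (hder z hz).hasFDerivAt⟩
  exact (ContinuousLinearMap.toSpanSingletonCLE (𝕜 := ℝ) (E := ℝ)).continuous.comp_continuousOn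
    (continuousOn_const.mul hcont)

/-- The relation `a = μ h''` holds on all of `S`, since it holds where `h'' ≠ 0`. -/
theorem eq_mobility_mul {S : Set ℝ} {a h μ : ℝ → ℝ}
    (ha : ∀ u ∈ S, ContDiffAt ℝ ∞ a u) (hh : ∀ u ∈ S, ContDiffAt ℝ ∞ h u)
    (hμ : ∀ u ∈ S, ContDiffAt ℝ ∞ μ u)
    (hdense : S ⊆ closure {u ∈ S | deriv (deriv h) u ≠ 0})
    (hμ_eq : ∀ u ∈ S, deriv (deriv h) u ≠ 0 → μ u = a u / deriv (deriv h) u) {u : ℝ}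
    (hu : u ∈ S) : a u = μ u * deriv (deriv h) u := by
  have hcont : ContinuousAt (fun v => a v - μ v * deriv (deriv h) v) u :=
    (ha u hu).continuousAt.sub ((hμ u hu).continuousAt.mul
      (contDiffAt_infty_deriv (contDiffAt_infty_deriv (hh u hu))).continuousAt)
  by_contra hne
  have h1 := hcont.eventually_ne (sub_ne_zero.2 hne)
  obtain ⟨v, ⟨hvS, hv0⟩, hv⟩ := ((mem_closure_iff_frequently.1 (hdense hu)).and_eventually h1).exists
  refine hv ?_
  rw [hμ_eq v hvS hv0, div_mul_cancel₀ _ hv0, sub_self]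

/-! ### The Bochner terms at a point -/

section Pointwise

variable {D : Set (Space d)} {u w β : Space d → ℝ} {x : Space d}

/-- The field `q ∇w`, `q = B |∇w|²`, has divergence
`⟨∇B, ∇w⟩ |∇w|² + 2 B ⟨∇w, ∇²w ∇w⟩ + B |∇w|² Δw`. -/
theorem sum_pd_mul_normSq_mul_pd (hD : UniqueDiffOn ℝ D) (hx : x ∈ D)
    (hw : ContDiffOn ℝ ∞ w D) {B : Space d → ℝ} (hB : DifferentiableOn ℝ B D) :
    ∑ i, pd D i (fun y => B y * (∑ j, pd D j w y ^ 2) * pd D i w y) x =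
      (∑ i, pd D i B x * pd D i w x) * (∑ j, pd D j w x ^ 2) +
        2 * B x * (∑ i, ∑ j, pd D i (pd D j w) x * pd D j w x * pd D i w x) +
        B x * (∑ j, pd D j w x ^ 2) * ∑ i, pd D i (pd D i w) x := by
  have h1 : ∀ i, DifferentiableOn ℝ (pd D i w) D := fun i =>
    (contDiffOn_pd hD hw i).differentiableOn (by simp)
  have hq : DifferentiableOn ℝ (fun y => ∑ j, pd D j w y * pd D j w y) D :=
    DifferentiableOn.fun_sum fun j _ => (h1 j).fun_mul (h1 j)
  simp only [pow_two]
  have key : ∀ i, pd D i (fun y => B y * (∑ j, pd D j w y * pd D j w y) * pd D i w y) x =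
      pd D i B x * pd D i w x * (∑ j, pd D j w x * pd D j w x) +
        2 * B x * (∑ j, pd D i (pd D j w) x * pd D j w x * pd D i w x) +
        B x * (∑ j, pd D j w x * pd D j w x) * pd D i (pd D i w) x := by
    intro i
    rw [pd_mul hD hx (hB.fun_mul hq) (h1 i), pd_mul hD hx hB hq,
      pd_sum hD hx fun j => (h1 j).fun_mul (h1 j)]
    have : ∑ j, pd D i (fun y => pd D j w y * pd D j w y) x =
        2 * ∑ j, pd D i (pd D j w) x * pd D j w x := by
      rw [Finset.mul_sum]
      refine Finset.sum_congr rfl fun j _ => ?_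
      rw [pd_mul hD hx (h1 j) (h1 j)]
      ring
    rw [this, ← Finset.sum_mul _ _ (pd D i w x)]
    ring
  simp only [key, Finset.sum_add_distrib, ← Finset.sum_mul, ← Finset.mul_sum]

/-- The divergence of `β (∇²w ∇w - Δw ∇w)`: the third derivatives of `w` cancel. -/
theorem sum_pd_mul_hessian (hD : UniqueDiffOn ℝ D) (hx : x ∈ D) (hx' : x ∈ closure (interior D))
    (hw : ContDiffOn ℝ ∞ w D) (hβ : DifferentiableOn ℝ β D) :
    ∑ i, pd D i (fun y => β y * ((∑ j, pd D j (pd D i w) y * pd D j w y) -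
        (∑ j, pd D j (pd D j w) y) * pd D i w y)) x =
      (∑ i, ∑ j, pd D i β x * pd D i (pd D j w) x * pd D j w x) -
        (∑ i, pd D i (pd D i w) x) * (∑ i, pd D i β x * pd D i w x) +
        β x * ((∑ i, ∑ j, pd D i (pd D j w) x ^ 2) - (∑ i, pd D i (pd D i w) x) ^ 2) := by
  have c1 : ∀ i, ContDiffOn ℝ ∞ (pd D i w) D := contDiffOn_pd hD hw
  have h1 : ∀ i, DifferentiableOn ℝ (pd D i w) D := fun i => (c1 i).differentiableOn (by simp)
  have h2 : ∀ i j, DifferentiableOn ℝ (pd D j (pd D i w)) D := fun i j =>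
    (contDiffOn_pd hD (c1 i) j).differentiableOn (by simp)
  have hs1 : ∀ i, DifferentiableOn ℝ (fun y => ∑ j, pd D j (pd D i w) y * pd D j w y) D :=
    fun i => DifferentiableOn.fun_sum fun j _ => (h2 i j).fun_mul (h1 j)
  have hs2 : DifferentiableOn ℝ (fun y => ∑ j, pd D j (pd D j w) y) D :=
    DifferentiableOn.fun_sum fun j _ => h2 j j
  have key : ∀ i, pd D i (fun y => β y * ((∑ j, pd D j (pd D i w) y * pd D j w y) -
        (∑ j, pd D j (pd D j w) y) * pd D i w y)) x =
      (∑ j, pd D i β x * pd D i (pd D j w) x * pd D j w x) -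
        (∑ i, pd D i (pd D i w) x) * (pd D i β x * pd D i w x) +
        β x * ((∑ j, pd D j (pd D i (pd D i w)) x * pd D j w x) -
          (∑ j, pd D i (pd D j (pd D j w)) x * pd D i w x) +
          (∑ j, pd D i (pd D j w) x ^ 2) -
          (∑ i, pd D i (pd D i w) x) * pd D i (pd D i w) x) := by
    intro i
    rw [pd_mul hD hx hβ ((hs1 i).fun_sub (hs2.fun_mul (h1 i))),
      pd_sub hD hx (hs1 i) (hs2.fun_mul (h1 i)), pd_mul hD hx hs2 (h1 i),
      pd_sum hD hx (fun j => h2 j j), pd_sum hD hx (fun j => (h2 i j).fun_mul (h1 j))]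
    have e1 : ∑ j, pd D i (fun y => pd D j (pd D i w) y * pd D j w y) x =
        (∑ j, pd D j (pd D i (pd D i w)) x * pd D j w x) + ∑ j, pd D i (pd D j w) x ^ 2 := by
      rw [← Finset.sum_add_distrib]
      refine Finset.sum_congr rfl fun j _ => ?_
      rw [pd_mul hD hx (h2 i j) (h1 j), pd_symm hD (c1 i) hx hx' (i := i) (j := j),
        pd_symm hD hw hx hx' (i := j) (j := i)]
      ring
    have e2 : ∑ j, pd D j (pd D i w) x * pd D j w x = ∑ j, pd D i (pd D j w) x * pd D j w x :=
      Finset.sum_congr rfl fun j _ => by rw [pd_symm hD hw hx hx' (i := j) (j := i)]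
    have e3 : ∑ j, pd D i β x * pd D i (pd D j w) x * pd D j w x =
        pd D i β x * ∑ j, pd D i (pd D j w) x * pd D j w x := by
      rw [Finset.mul_sum]
      exact Finset.sum_congr rfl fun j _ => by ring
    rw [e1, e2, e3, ← Finset.sum_mul]
    ring
  simp only [key, Finset.sum_add_distrib, Finset.sum_sub_distrib, ← Finset.mul_sum]
  rw [Finset.sum_comm (f := fun i j => pd D j (pd D i (pd D i w)) x * pd D j w x)]
  ring

end Pointwise

/-- The pointwise inequality behind the theorem, for the values `p = ∇u`, `H = ∇²w`, `g = h''(u)`,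
`m = μ(u)`, `β = b(u)` at one point, where `w = h'(u)`, hence `∇w = g p`. The first two lines of
the right side are the integrand of the second variation, the others the two divergences that are
added to it; the terms that mix `H` with `p` cancel. -/
theorem bochner_algebra_le (hd : 0 < d) {C g m m₁ m₂ β : ℝ} (p : Fin d → ℝ)
    (H : Fin d → Fin d → ℝ) (hβ0 : 0 ≤ β)
    (hβ : ((d : ℝ) - 1) / d * β ≤ (C + 1) * g * m ^ 2) :
    -(1 / 3) * ((C + 2) * m * m₂ + (C - 1) * m₁ ^ 2) *
        ((∑ i, p i * (g * p i)) * ∑ j, (g * p j) ^ 2) ≤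
      g * (m * (∑ i, H i i) + m₁ * ∑ i, p i * (g * p i)) ^ 2 +
        C * (m * g * (m * (∑ i, H i i) + m₁ * ∑ i, p i * (g * p i))) * (∑ i, H i i) +
      ((∑ i, -(1 / 3) * (C + 2) * (m₁ ^ 2 + m * m₂) * p i * (g * p i)) * (∑ j, (g * p j) ^ 2) +
        2 * (-(1 / 3) * (C + 2) * (m * m₁)) * (∑ i, ∑ j, H i j * (g * p j) * (g * p i)) +
        -(1 / 3) * (C + 2) * (m * m₁) * (∑ j, (g * p j) ^ 2) * ∑ i, H i i) +
      ((∑ i, ∑ j, 2 / 3 * (C + 2) * (m * m₁ * g) * p i * H i j * (g * p j)) -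
        (∑ i, H i i) * (∑ i, 2 / 3 * (C + 2) * (m * m₁ * g) * p i * (g * p i)) +
        β * ((∑ i, ∑ j, H i j ^ 2) - (∑ i, H i i) ^ 2)) := by
  set L := ∑ i, H i i with hL
  set N := ∑ i, ∑ j, H i j ^ 2 with hN
  set P := ∑ i, p i ^ 2 with hP
  set X := ∑ i, ∑ j, H i j * p i * p j with hX
  have e1 : ∑ i, p i * (g * p i) = g * P := by
    rw [hP, Finset.mul_sum]; exact Finset.sum_congr rfl fun i _ => by ring
  have e2 : ∑ j, (g * p j) ^ 2 = g ^ 2 * P := by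
    rw [hP, Finset.mul_sum]; exact Finset.sum_congr rfl fun i _ => by ring
  have e3 : ∑ i, ∑ j, H i j * (g * p j) * (g * p i) = g ^ 2 * X := by
    simp_rw [hX, Finset.mul_sum]
    exact Finset.sum_congr rfl fun i _ => Finset.sum_congr rfl fun j _ => by ring
  have e4 : ∑ i, ∑ j, 2 / 3 * (C + 2) * (m * m₁ * g) * p i * H i j * (g * p j) =
      2 / 3 * (C + 2) * (m * m₁ * g) * g * X := by
    simp_rw [hX, Finset.mul_sum]
    exact Finset.sum_congr rfl fun i _ => Finset.sum_congr rfl fun j _ => by ring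
  have e5 : ∀ c : ℝ, ∑ i, c * p i * (g * p i) = c * g * P := by
    intro c
    rw [hP, Finset.mul_sum]; exact Finset.sum_congr rfl fun i _ => by ring
  rw [e1, e2, e3, e4, e5, e5]
  have hLN : L ^ 2 ≤ d * N := by
    have h1 : L ^ 2 ≤ (d : ℝ) * ∑ i, H i i ^ 2 := by
      simpa using sq_sum_le_card_mul_sum_sq (s := Finset.univ) (f := fun i => H i i)
    have h2 : ∑ i, H i i ^ 2 ≤ N := Finset.sum_le_sum fun i _ =>
      Finset.single_le_sum (f := fun j => H i j ^ 2) (fun j _ => sq_nonneg _) (Finset.mem_univ i)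
    exact h1.trans (mul_le_mul_of_nonneg_left h2 (Nat.cast_nonneg d))
  have hd' : (0 : ℝ) < d := Nat.cast_pos.2 hd
  have hmain : 0 ≤ ((C + 1) * g * m ^ 2 - β) * L ^ 2 + β * N := by
    have h1 : L ^ 2 / d ≤ N := by rw [div_le_iff₀ hd']; linarith
    have h2 := mul_le_mul_of_nonneg_left h1 hβ0
    have h3 := mul_le_mul_of_nonneg_right hβ (sq_nonneg L)
    have h4 : ((d : ℝ) - 1) / d * β * L ^ 2 = β * L ^ 2 - β * (L ^ 2 / d) := by
      field_simp
    nlinarith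
  nlinarith [hmain]

end

/-! ### Positivity of the second variation -/

section

variable {d : ℕ} {bc : BoundaryCondition d} {Ω : Set (Space d)}

/-- The structural conditions on the diffusion coefficient `a`, the entropy density `h` and the
mobility `μ` on the interval `S`, for the constant `C = C_RK`. The relation between the three
functions is in product form, which also covers the zeros of `h''`. -/
structure StructuralConditions (d : ℕ) (C : ℝ) (S : Set ℝ) (a h μ : ℝ → ℝ) (u₀ : ℝ) : Prop where
  smooth_a : ∀ u ∈ S, ContDiffAt ℝ ∞ a u
  smooth_h : ∀ u ∈ S, ContDiffAt ℝ ∞ h u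
  smooth_mobility : ∀ u ∈ S, ContDiffAt ℝ ∞ μ u
  dense : S ⊆ closure {u ∈ S | deriv (deriv h) u ≠ 0}
  eq_mul : ∀ u ∈ S, a u = μ u * deriv (deriv h) u
  convex : ∀ u ∈ S, 0 ≤ deriv (deriv h) u
  integrable : ∀ u ∈ S, IntervalIntegrable
    (fun v => μ v * deriv μ v * deriv (deriv h) v) volume u₀ u
  bFun_nonneg : ∀ u ∈ S, 0 ≤ bFun C μ h u₀ u
  bFun_le : ∀ u ∈ S, ((d : ℝ) - 1) / d * bFun C μ h u₀ u ≤ (C + 1) * deriv (deriv h) u * μ u ^ 2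
  neg : ∀ u ∈ S, (C + 2) * μ u * deriv (deriv μ) u + (C - 1) * deriv μ u ^ 2 < 0

/-- `h'(u)` inherits the boundary condition of `u`. -/
theorem BoundaryCondition.IsDomain.holds_comp (hΩ : bc.IsDomain Ω) {u : Space d → ℝ}
    (hu : DifferentiableOn ℝ u (bc.region Ω)) (hubc : bc.Holds Ω u) {φ : ℝ → ℝ}
    (hφ : ∀ x ∈ bc.region Ω, DifferentiableAt ℝ φ (u x)) : bc.Holds Ω fun x => φ (u x) := by
  cases bc with
  | neumann =>
    intro p hp ν hν
    have hpc := frontier_subset_closure hp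
    have h := ((hφ p hpc).hasDerivAt.comp_hasFDerivWithinAt p
      (hu p hpc).hasFDerivWithinAt).fderivWithin (hΩ.uniqueDiffOn p hpc)
    rw [show (fun x => φ (u x)) = φ ∘ u from rfl]
    simp only [BoundaryCondition.region] at h
    rw [h]
    simp [hubc p hp ν hν]
  | periodic L => exact fun i x => congrArg φ (hubc i x)

section SecondVariation

variable {C u₀ : ℝ} {S : Set ℝ} {a h μ : ℝ → ℝ} {u : Space d → ℝ}

/-- If `h''(u) ∇u` vanishes identically, `u` is constant, because `h''` vanishes on no interval. -/
theorem StructuralConditions.exists_mul_pd_ne_zero (hs : StructuralConditions d C S a h μ u₀)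
    (hS : S.OrdConnected) (hΩ : bc.IsDomain Ω) (hu : ContDiffOn ℝ ∞ u (bc.region Ω))
    (huS : ∀ x ∈ bc.region Ω, u x ∈ S) (hconst : ¬ ∃ c : ℝ, ∀ x ∈ Ω, u x = c) :
    ∃ x ∈ Ω, ∃ i, deriv (deriv h) (u x) * pd (bc.region Ω) i u x ≠ 0 := by
  by_contra hno
  push Not at hno
  have hD := hΩ.uniqueDiffOn
  have hsub := bc.subset_region Ω
  have hud := hu.differentiableOn (by simp)
  have hdh : ∀ v ∈ S, DifferentiableAt ℝ (deriv h) v := fun v hv =>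
    (contDiffAt_infty_deriv (hs.smooth_h v hv)).differentiableAt (by simp)
  have hwd : DifferentiableOn ℝ (fun x => deriv h (u x)) (bc.region Ω) := fun x hx =>
    (hdh _ (huS x hx)).comp_differentiableWithinAt x (hud x hx)
  have hder : ∀ x ∈ Ω, fderivWithin ℝ (fun x => deriv h (u x)) Ω x = 0 := by
    intro x hx
    rw [fderivWithin_of_mem_nhds (hΩ.isOpen.mem_nhds hx),
      ← fderivWithin_of_mem_nhds (hΩ.region_mem_nhds hx)]
    ext v
    rw [fderivWithin_apply_eq_sum_pd]
    refine Finset.sum_eq_zero fun i _ => ?_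
    rw [pd_comp hD (hsub hx) hud (hdh _ (huS x (hsub hx))), hno x hx i, mul_zero]
  have hw : ∀ x ∈ Ω, ∀ y ∈ Ω, deriv h (u x) = deriv h (u y) := fun x hx y hy =>
    hΩ.convex.is_const_of_fderivWithin_eq_zero (𝕜 := ℝ) (hwd.mono hsub) hder hx hy
  -- two points with different values
  obtain ⟨x, hx, y, hy, hlt⟩ : ∃ x ∈ Ω, ∃ y ∈ Ω, u x < u y := by
    obtain ⟨x, hx⟩ := hΩ.nonempty
    by_contra hall
    push Not at hall
    exact hconst ⟨u x, fun y hy => le_antisymm (hall x hx y hy) (hall y hy x hx)⟩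
  have himg : Icc (u x) (u y) ⊆ u '' Ω :=
    hΩ.convex.isPreconnected.intermediate_value hx hy (hu.continuousOn.mono hsub)
  have hconst' : ∀ v ∈ Icc (u x) (u y), deriv h v = deriv h (u x) := by
    intro v hv
    obtain ⟨z, hz, rfl⟩ := himg hv
    exact hw z hz x hx
  have hzero : ∀ v ∈ Ioo (u x) (u y), deriv (deriv h) v = 0 := by
    intro v hv
    have : deriv h =ᶠ[𝓝 v] fun _ => deriv h (u x) := by
      filter_upwards [Ioo_mem_nhds hv.1 hv.2] with z hz using hconst' z (Ioo_subset_Icc_self hz)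
    rw [this.deriv_eq, deriv_const]
  obtain ⟨m, hm⟩ := exists_between hlt
  have hmS : m ∈ S := hS.out (huS x (hsub hx)) (huS y (hsub hy)) ⟨hm.1.le, hm.2.le⟩
  obtain ⟨v, hv, hv'⟩ := mem_closure_iff_nhds.1 (hs.dense hmS) _ (Ioo_mem_nhds hm.1 hm.2)
  exact hv'.2 (hzero v hv)

/-- The second variation of the entropy along the scheme, in the form
`∫ (h''(u) κ² + C a(u) κ Δw)` with `κ = div (a(u) ∇u)` and `w = h'(u)`, is positive. -/
theorem StructuralConditions.second_variation_laplacian_pos (hs : StructuralConditions d C S a h μ u₀)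
    (hS : S.OrdConnected) (hΩ : bc.IsDomain Ω) (hu : ContDiffOn ℝ ∞ u (bc.region Ω))
    (hubc : bc.Holds Ω u) (huS : ∀ x ∈ bc.region Ω, u x ∈ S)
    (hconst : ¬ ∃ c : ℝ, ∀ x ∈ Ω, u x = c) {κ : Space d → ℝ}
    (hκ : κ = fun x => ∑ i, pd (bc.region Ω) i (fun y => a (u y) * pd (bc.region Ω) i u y) x) :
    0 < ∫ x in Ω, (deriv (deriv h) (u x) * κ x ^ 2 + C * (a (u x) * κ x) *
      ∑ i, pd (bc.region Ω) i (pd (bc.region Ω) i fun y => deriv h (u y)) x) := by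
  have hD := hΩ.uniqueDiffOn
  have hsub := bc.subset_region Ω
  have hint : ∀ x ∈ Ω, x ∈ closure (interior (bc.region Ω)) := fun x hx =>
    subset_closure (mem_interior_iff_mem_nhds.2 (hΩ.region_mem_nhds hx))
  -- a nonconstant `u` excludes `d = 0`, where the quotient `(d - 1) / d` would be a junk value
  have hd : 0 < d := by
    obtain ⟨_, _, i, _⟩ := hs.exists_mul_pd_ne_zero hS hΩ hu huS hconst
    exact i.pos
  set D := bc.region Ω with hDdef
  set w : Space d → ℝ := fun y => deriv h (u y) with hwdef
  have sh1 : ∀ v ∈ S, ContDiffAt ℝ ∞ (deriv h) v := fun v hv =>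
    contDiffAt_infty_deriv (hs.smooth_h v hv)
  have sh2 : ∀ v ∈ S, ContDiffAt ℝ ∞ (deriv (deriv h)) v := fun v hv =>
    contDiffAt_infty_deriv (sh1 v hv)
  have sm1 : ∀ v ∈ S, ContDiffAt ℝ ∞ (deriv μ) v := fun v hv =>
    contDiffAt_infty_deriv (hs.smooth_mobility v hv)
  have sm2 : ∀ v ∈ S, ContDiffAt ℝ ∞ (deriv (deriv μ)) v := fun v hv =>
    contDiffAt_infty_deriv (sm1 v hv)
  have hud : DifferentiableOn ℝ u D := hu.differentiableOn (by simp)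
  have hw : ContDiffOn ℝ ∞ w D := contDiffOn_comp_of_forall_mem sh1 hu huS
  have hwbc : bc.Holds Ω w := hΩ.holds_comp hud hubc fun x hx =>
    (sh1 _ (huS x hx)).differentiableAt (by simp)
  have cg : ContDiffOn ℝ ∞ (fun x => deriv (deriv h) (u x)) D :=
    contDiffOn_comp_of_forall_mem sh2 hu huS
  have cm : ContDiffOn ℝ ∞ (fun x => μ (u x)) D :=
    contDiffOn_comp_of_forall_mem hs.smooth_mobility hu huS
  have cm1 : ContDiffOn ℝ ∞ (fun x => deriv μ (u x)) D := contDiffOn_comp_of_forall_mem sm1 hu huS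
  have cm2 : ContDiffOn ℝ ∞ (fun x => deriv (deriv μ) (u x)) D :=
    contDiffOn_comp_of_forall_mem sm2 hu huS
  have ca : ContDiffOn ℝ ∞ (fun x => a (u x)) D :=
    contDiffOn_comp_of_forall_mem hs.smooth_a hu huS
  have cpu := contDiffOn_pd hD hu
  have cpw := contDiffOn_pd hD hw
  have cppw := fun i j => contDiffOn_pd hD (cpw i) j
  have hpdw : ∀ i, ∀ x ∈ D, pd D i w x = deriv (deriv h) (u x) * pd D i u x := fun i x hx =>
    pd_comp hD hx hud ((sh1 _ (huS x hx)).differentiableAt (by simp))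
  have hcκ : ContDiffOn ℝ ∞ κ D := by
    rw [hκ]
    exact ContDiffOn.sum fun i _ => contDiffOn_pd hD (ca.mul (cpu i)) i
  -- `a ∇u = μ ∇w`, hence `κ = μ Δw + μ' ⟨∇u, ∇w⟩`
  have hκ' : ∀ x ∈ D, κ x = μ (u x) * (∑ i, pd D i (pd D i w) x) +
      deriv μ (u x) * ∑ i, pd D i u x * (deriv (deriv h) (u x) * pd D i u x) := by
    intro x hx
    have e : ∀ i, pd D i (fun y => a (u y) * pd D i u y) x =
        μ (u x) * pd D i (pd D i w) x +
          deriv μ (u x) * (pd D i u x * (deriv (deriv h) (u x) * pd D i u x)) := by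
      intro i
      rw [pd_congr (g := fun y => μ (u y) * pd D i w y) (fun y hy => by
        beta_reduce
        rw [hpdw i y hy, ← mul_assoc, ← hs.eq_mul _ (huS y hy)]) hx,
        pd_mul hD hx (cm.differentiableOn (by simp)) ((cpw i).differentiableOn (by simp)),
        pd_comp hD hx hud ((hs.smooth_mobility _ (huS x hx)).differentiableAt (by simp)),
        hpdw i x hx]
      ring
    rw [hκ]
    simp only [e, Finset.sum_add_distrib, ← Finset.mul_sum]
  -- the two integrations by parts
  set B : Space d → ℝ := fun x => -(1 / 3) * (C + 2) * (μ (u x) * deriv μ (u x)) with hB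
  have cB : ContDiffOn ℝ ∞ B D := contDiffOn_const.mul (cm.mul cm1)
  have hBpd : ∀ i, ∀ x ∈ D, pd D i B x = -(1 / 3) * (C + 2) *
      (deriv μ (u x) ^ 2 + μ (u x) * deriv (deriv μ) (u x)) * pd D i u x := by
    intro i x hx
    rw [hB, pd_const_mul hD hx ((cm.mul cm1).differentiableOn (by simp)),
      pd_mul hD hx (cm.differentiableOn (by simp)) (cm1.differentiableOn (by simp)),
      pd_comp hD hx hud ((hs.smooth_mobility _ (huS x hx)).differentiableAt (by simp)),
      pd_comp hD hx hud ((sm1 _ (huS x hx)).differentiableAt (by simp))]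
    ring
  set β : Space d → ℝ := fun x => bFun C μ h u₀ (u x) with hβ
  have hbF := fun v (hv : v ∈ S) => bFun_hasDerivAt_and_contDiffAt (C := C)
    (hs.smooth_mobility v hv) (hs.smooth_h v hv) (hs.integrable v hv)
  have cβ : ContDiffOn ℝ 1 β D := contDiffOn_comp_of_forall_mem (fun v hv => (hbF v hv).2)
    (hu.of_le (by norm_cast)) huS
  have hβpd : ∀ i, ∀ x ∈ D, pd D i β x = 2 / 3 * (C + 2) *
      (μ (u x) * deriv μ (u x) * deriv (deriv h) (u x)) * pd D i u x := by
    intro i x hx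
    rw [hβ, pd_comp hD hx hud (hbF _ (huS x hx)).1.differentiableAt, (hbF _ (huS x hx)).1.deriv]
  have uinv := hubc.invariant
  have cBq : ContDiffOn ℝ ∞ (fun y => B y * ∑ j, pd D j w y ^ 2) D :=
    cB.mul (ContDiffOn.sum fun j _ => (cpw j).pow 2)
  have hJ1 := hΩ.integral_sum_pd_mul_pd hw hwbc (g := fun y => B y * ∑ j, pd D j w y ^ 2)
    (cBq.of_le (by norm_cast))
    ((uinv.comp fun v => -(1 / 3) * (C + 2) * (μ v * deriv μ v)).mul
      (BoundaryCondition.Invariant.sum fun j => (hwbc.invariant.pd j).comp fun v => v ^ 2))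
  have hJ2 := hΩ.integral_sum_pd_hessian_nonpos hw hwbc cβ (uinv.comp _)
    fun x hx => hs.bFun_nonneg _ (huS x hx)
  rw [← hDdef] at hJ1 hJ2
  set E : Space d → ℝ := fun x => deriv (deriv h) (u x) * κ x ^ 2 + C * (a (u x) * κ x) *
    ∑ i, pd D i (pd D i w) x with hE
  set J1 : Space d → ℝ := fun x =>
    ∑ i, pd D i (fun y => B y * (∑ j, pd D j w y ^ 2) * pd D i w y) x with hJ1def
  set J2 : Space d → ℝ := fun x => ∑ i, pd D i (fun y => β y *
    ((∑ j, pd D j (pd D i w) y * pd D j w y) -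
      (∑ j, pd D j (pd D j w) y) * pd D i w y)) x with hJ2def
  set R : Space d → ℝ := fun x => -(1 / 3) * ((C + 2) * μ (u x) * deriv (deriv μ) (u x) +
      (C - 1) * deriv μ (u x) ^ 2) *
    ((∑ i, pd D i u x * (deriv (deriv h) (u x) * pd D i u x)) *
      ∑ j, (deriv (deriv h) (u x) * pd D j u x) ^ 2) with hR
  have hpoint : ∀ x ∈ Ω, R x ≤ E x + J1 x + J2 x := by
    intro x hxΩ
    have hx := hsub hxΩ
    have key := bochner_algebra_le hd (C := C) (m₁ := deriv μ (u x)) (m₂ := deriv (deriv μ) (u x))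
      (fun i => pd D i u x) (fun i j => pd D i (pd D j w) x)
      (hs.bFun_nonneg _ (huS x hx)) (hs.bFun_le _ (huS x hx))
    rw [← hκ' x hx, ← hs.eq_mul _ (huS x hx)] at key
    simp only [hR, hE, hJ1def, hJ2def]
    rw [sum_pd_mul_normSq_mul_pd hD hx hw (cB.differentiableOn (by simp)),
      sum_pd_mul_hessian hD hx (hint x hxΩ) hw (cβ.differentiableOn (by simp))]
    simp only [hBpd _ x hx, hβpd _ x hx, hpdw _ x hx]
    exact key
  have hR0 : ∀ x ∈ D, 0 ≤ R x := by
    intro x hx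
    have h1 := hs.neg _ (huS x hx)
    have h2 := hs.convex _ (huS x hx)
    refine mul_nonneg (by linarith) (mul_nonneg (Finset.sum_nonneg fun i _ => ?_)
      (Finset.sum_nonneg fun i _ => sq_nonneg _))
    have := mul_nonneg h2 (sq_nonneg (pd D i u x))
    linarith
  have contR : ContinuousOn R D := by
    have hc := cg.continuousOn
    have hp := fun i => (cpu i).continuousOn
    exact (continuousOn_const.mul (((continuousOn_const.mul cm.continuousOn).mul
      cm2.continuousOn).add (continuousOn_const.mul (cm1.continuousOn.pow 2)))).mul
      ((continuousOn_finsetSum _ fun i _ => (hp i).mul (hc.mul (hp i))).mul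
        (continuousOn_finsetSum _ fun i _ => (hc.mul (hp i)).pow 2))
  have contE : ContinuousOn E D :=
    (cg.continuousOn.mul (hcκ.continuousOn.pow 2)).add
      ((continuousOn_const.mul (ca.continuousOn.mul hcκ.continuousOn)).mul
        (continuousOn_finsetSum _ fun i _ => (cppw i i).continuousOn))
  have contJ1 : ContinuousOn J1 D := continuousOn_finsetSum _ fun i _ =>
    (contDiffOn_pd hD (cBq.mul (cpw i)) i).continuousOn
  have contJ2 : ContinuousOn J2 D := continuousOn_finsetSum _ fun i _ =>
    continuousOn_pd hD (cβ.mul (((ContDiffOn.sum fun j _ => (cppw i j).mul (cpw j)).sub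
      ((ContDiffOn.sum fun j _ => cppw j j).mul (cpw i))).of_le (by norm_cast))) i
  have iE := hΩ.integrableOn contE
  have iJ1 := hΩ.integrableOn contJ1
  have iJ2 := hΩ.integrableOn contJ2
  have iR := hΩ.integrableOn contR
  have hle : ∫ x in Ω, R x ≤ ∫ x in Ω, E x := by
    have h1 : ∫ x in Ω, R x ≤ ∫ x in Ω, (E x + J1 x + J2 x) :=
      setIntegral_mono_on iR ((iE.add iJ1).add iJ2) hΩ.isOpen.measurableSet hpoint
    have h2 : ∫ x in Ω, (E x + J1 x + J2 x) =
        (∫ x in Ω, E x) + (∫ x in Ω, J1 x) + ∫ x in Ω, J2 x := by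
      rw [← integral_add iE iJ1]
      exact integral_add (iE.add iJ1) iJ2
    linarith
  refine lt_of_lt_of_le ?_ hle
  -- strict positivity
  obtain ⟨x, hx, i, hi⟩ := hs.exists_mul_pd_ne_zero hS hΩ hu huS hconst
  have hRx : 0 < R x := by
    have hxD := hsub hx
    have h1 := hs.neg _ (huS x hxD)
    have h2 : 0 < deriv (deriv h) (u x) := lt_of_le_of_ne (hs.convex _ (huS x hxD))
      (left_ne_zero_of_mul hi).symm
    have h3 : pd D i u x ≠ 0 := right_ne_zero_of_mul hi
    refine mul_pos (by linarith) (mul_pos ?_ ?_)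
    · refine Finset.sum_pos' (fun j _ => ?_) ⟨i, Finset.mem_univ i, ?_⟩
      · have := mul_nonneg h2.le (sq_nonneg (pd D j u x))
        linarith
      · have := mul_pos h2 (pow_pos (abs_pos.2 h3) 2)
        rw [sq_abs] at this
        linarith
    · refine Finset.sum_pos' (fun j _ => sq_nonneg _) ⟨i, Finset.mem_univ i, ?_⟩
      positivity
  rw [setIntegral_pos_iff_support_of_nonneg_ae
    (ae_restrict_of_forall_mem hΩ.isOpen.measurableSet fun y hy => hR0 y (hsub hy)) iR]
  have hpos : ∀ᶠ y in 𝓝 x, y ∈ Function.support R ∩ Ω := by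
    have hcx : ContinuousAt R x := contR.continuousAt (hΩ.region_mem_nhds hx)
    filter_upwards [hcx.eventually_const_lt hRx, hΩ.isOpen.mem_nhds hx] with y hy hyΩ
    exact ⟨hy.ne', hyΩ⟩
  exact Measure.measure_pos_of_mem_nhds volume hpos

/-- The second variation in the form in which it arises from the scheme. -/
theorem StructuralConditions.second_variation_pos (hs : StructuralConditions d C S a h μ u₀)
    (hS : S.OrdConnected) (hΩ : bc.IsDomain Ω) (hu : ContDiffOn ℝ ∞ u (bc.region Ω))
    (hubc : bc.Holds Ω u) (huS : ∀ x ∈ bc.region Ω, u x ∈ S)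
    (hconst : ¬ ∃ c : ℝ, ∀ x ∈ Ω, u x = c) {κ : Space d → ℝ}
    (hκ : κ = fun x => ∑ i, pd (bc.region Ω) i (fun y => a (u y) * pd (bc.region Ω) i u y) x) :
    0 < ∫ x in Ω, (deriv (deriv h) (u x) * κ x ^ 2 - C * ∑ i, deriv (deriv h) (u x) *
      pd (bc.region Ω) i u x * pd (bc.region Ω) i (fun y => a (u y) * κ y) x) := by
  have hpos := hs.second_variation_laplacian_pos hS hΩ hu hubc huS hconst hκ
  have hD := hΩ.uniqueDiffOn
  have hsub := bc.subset_region Ω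
  set D := bc.region Ω with hDdef
  set w : Space d → ℝ := fun y => deriv h (u y) with hwdef
  have sh1 : ∀ v ∈ S, ContDiffAt ℝ ∞ (deriv h) v := fun v hv =>
    contDiffAt_infty_deriv (hs.smooth_h v hv)
  have hud : DifferentiableOn ℝ u D := hu.differentiableOn (by simp)
  have hw : ContDiffOn ℝ ∞ w D := contDiffOn_comp_of_forall_mem sh1 hu huS
  have hwbc : bc.Holds Ω w := hΩ.holds_comp hud hubc fun x hx =>
    (sh1 _ (huS x hx)).differentiableAt (by simp)
  have cg : ContDiffOn ℝ ∞ (fun x => deriv (deriv h) (u x)) D :=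
    contDiffOn_comp_of_forall_mem (fun v hv => contDiffAt_infty_deriv (sh1 v hv)) hu huS
  have ca : ContDiffOn ℝ ∞ (fun x => a (u x)) D :=
    contDiffOn_comp_of_forall_mem hs.smooth_a hu huS
  have cpu := contDiffOn_pd hD hu
  have cpw := contDiffOn_pd hD hw
  have hcκ : ContDiffOn ℝ ∞ κ D := by
    rw [hκ]
    exact ContDiffOn.sum fun i _ => contDiffOn_pd hD (ca.mul (cpu i)) i
  have cak : ContDiffOn ℝ ∞ (fun y => a (u y) * κ y) D := ca.mul hcκ
  have κinv : bc.Invariant κ := by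
    rw [hκ]
    exact BoundaryCondition.Invariant.sum fun i =>
      ((hubc.invariant.comp a).mul (hubc.invariant.pd i)).pd i
  have hJ := hΩ.integral_sum_pd_mul_pd hw hwbc (g := fun y => a (u y) * κ y)
    (cak.of_le (by norm_cast)) ((hubc.invariant.comp a).mul κinv)
  rw [← hDdef] at hJ
  set J : Space d → ℝ := fun x => ∑ i, pd D i (fun y => a (u y) * κ y * pd D i w y) x with hJdef
  have contJ : ContinuousOn J D := continuousOn_finsetSum _ fun i _ =>
    (contDiffOn_pd hD (cak.mul (cpw i)) i).continuousOn
  have contE : ContinuousOn (fun x => deriv (deriv h) (u x) * κ x ^ 2 + C * (a (u x) * κ x) *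
      ∑ i, pd D i (pd D i w) x) D :=
    (cg.continuousOn.mul (hcκ.continuousOn.pow 2)).add
      ((continuousOn_const.mul (ca.continuousOn.mul hcκ.continuousOn)).mul
        (continuousOn_finsetSum _ fun i _ => (contDiffOn_pd hD (cpw i) i).continuousOn))
  have hsplit : ∀ x ∈ Ω, deriv (deriv h) (u x) * κ x ^ 2 - C * ∑ i, deriv (deriv h) (u x) *
      pd D i u x * pd D i (fun y => a (u y) * κ y) x =
      (deriv (deriv h) (u x) * κ x ^ 2 + C * (a (u x) * κ x) * ∑ i, pd D i (pd D i w) x) -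
        C * J x := by
    intro x hxΩ
    have hx := hsub hxΩ
    have e : ∀ i, pd D i (fun y => a (u y) * κ y * pd D i w y) x =
        deriv (deriv h) (u x) * pd D i u x * pd D i (fun y => a (u y) * κ y) x +
          a (u x) * κ x * pd D i (pd D i w) x := by
      intro i
      rw [pd_mul hD hx (cak.differentiableOn (by simp)) ((cpw i).differentiableOn (by simp)),
        hwdef, pd_comp hD hx hud ((sh1 _ (huS x hx)).differentiableAt (by simp))]
      ring
    simp only [hJdef, e, Finset.sum_add_distrib, ← Finset.mul_sum]
    ring
  rw [setIntegral_congr_fun hΩ.isOpen.measurableSet hsplit,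
    integral_sub (hΩ.integrableOn contE) ((hΩ.integrableOn contJ).const_mul C),
    integral_const_mul, hJ, mul_zero, sub_zero]
  exact hpos

end SecondVariation

end

/-! ### Mean value formulas -/

section

variable {d : ℕ} {bc : BoundaryCondition d} {Ω : Set (Space d)}

section MeanValue

variable {S : Set ℝ} {φ : ℝ → ℝ} {x y : ℝ}

theorem add_mul_sub_mem (hS : S.OrdConnected) (hx : x ∈ S) (hy : y ∈ S) {t : ℝ}
    (ht : t ∈ Icc (0 : ℝ) 1) : x + t * (y - x) ∈ S := by
  have := hS.convex.add_smul_sub_mem hx hy ht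
  simpa using this

theorem exists_sub_eq_deriv_mul (hS : S.OrdConnected) (hφ : ∀ u ∈ S, ContDiffAt ℝ ∞ φ u)
    (hx : x ∈ S) (hy : y ∈ S) :
    ∃ t ∈ Icc (0 : ℝ) 1, φ y - φ x = deriv φ (x + t * (y - x)) * (y - x) := by
  have hψ : ∀ t ∈ Icc (0 : ℝ) 1, HasDerivAt (fun t => φ (x + t * (y - x)))
      (deriv φ (x + t * (y - x)) * (y - x)) t := by
    intro t ht
    have h1 := ((hφ _ (add_mul_sub_mem hS hx hy ht)).differentiableAt (by simp)).hasDerivAt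
    have h2 : HasDerivAt (fun t : ℝ => x + t * (y - x)) (y - x) t := by
      simpa using ((hasDerivAt_id t).mul_const (y - x)).const_add x
    exact h1.comp t h2
  obtain ⟨t, ht, he⟩ := exists_hasDerivAt_eq_slope (fun t => φ (x + t * (y - x))) _ one_pos
    (fun t ht => (hψ t ht).continuousAt.continuousWithinAt)
    fun t ht => hψ t (Ioo_subset_Icc_self ht)
  exact ⟨t, Ioo_subset_Icc_self ht, by simpa using he.symm⟩

theorem exists_sub_sub_eq_deriv_deriv_mul (hS : S.OrdConnected)
    (hφ : ∀ u ∈ S, ContDiffAt ℝ ∞ φ u) (hx : x ∈ S) (hy : y ∈ S) :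
    ∃ t ∈ Icc (0 : ℝ) 1, φ y - φ x - deriv φ x * (y - x) =
      1 / 2 * deriv (deriv φ) (x + t * (y - x)) * (y - x) ^ 2 := by
  have hlin : ∀ t : ℝ, HasDerivAt (fun t : ℝ => x + t * (y - x)) (y - x) t := fun t => by
    simpa using ((hasDerivAt_id t).mul_const (y - x)).const_add x
  set F : ℝ → ℝ := fun t => φ (x + t * (y - x)) + deriv φ (x + t * (y - x)) * (y - x) * (1 - t)
  have hF : ∀ t ∈ Icc (0 : ℝ) 1,
      HasDerivAt F (deriv (deriv φ) (x + t * (y - x)) * (y - x) ^ 2 * (1 - t)) t := by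
    intro t ht
    have hz := hφ _ (add_mul_sub_mem hS hx hy ht)
    have h1 := (hz.differentiableAt (by simp)).hasDerivAt.comp t (hlin t)
    have h2 := (((contDiffAt_infty_deriv hz).differentiableAt (by simp)).hasDerivAt.comp t
      (hlin t)).mul_const (y - x)
    have h3 := h1.add (h2.mul ((hasDerivAt_id t).const_sub 1))
    refine h3.congr_deriv ?_
    simp only [Function.comp_apply, id]
    ring
  have hG : ∀ t : ℝ, HasDerivAt (fun t : ℝ => -(1 / 2) * (1 - t) ^ 2) (1 - t) t := by
    intro t
    have := (((hasDerivAt_id t).const_sub 1).pow 2).const_mul (-(1 / 2) : ℝ)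
    refine this.congr_deriv ?_
    simp only [id]
    ring
  obtain ⟨t, ht, he⟩ := exists_ratio_hasDerivAt_eq_ratio_slope F _ one_pos
    (fun t ht => (hF t ht).continuousAt.continuousWithinAt)
    (fun t ht => hF t (Ioo_subset_Icc_self ht)) (fun t : ℝ => -(1 / 2) * (1 - t) ^ 2) _
    (fun t _ => (hG t).continuousAt.continuousWithinAt) fun t _ => hG t
  refine ⟨t, Ioo_subset_Icc_self ht, ?_⟩
  have ht1 : 1 - t ≠ 0 := by linarith [ht.2]
  have hF1 : F 1 = φ y := by simp [F]
  have hF0 : F 0 = φ x + deriv φ x * (y - x) := by simp [F]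
  rw [hF1, hF0] at he
  have he' : (1 - t) * (φ y - φ x - deriv φ x * (y - x) -
      1 / 2 * deriv (deriv φ) (x + t * (y - x)) * (y - x) ^ 2) = 0 := by
    linarith
  linarith [(mul_eq_zero.1 he').resolve_left ht1]

end MeanValue

/-! ### Smooth families and bounded convergence -/

section Families

variable {D : Set (Space d)} {τ₀ τ : ℝ} {f g : ℝ → Space d → ℝ}

theorem IsSmoothFamily.slice (hf : IsSmoothFamily τ₀ D f) (hτ : τ ∈ Ico 0 τ₀) :
    ContDiffOn ℝ ∞ (f τ) D :=
  ContDiffOn.comp hf (f := fun x => (τ, x)) (by fun_prop) fun _ hx => ⟨hτ, hx⟩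

theorem IsSmoothFamily.continuousOn_pd (hf : IsSmoothFamily τ₀ D f)
    (hD : UniqueDiffOn ℝ D) (i : Fin d) :
    ContinuousOn (fun q : ℝ × Space d => pd D i (f q.1) q.2) (Ico 0 τ₀ ×ˢ D) := by
  have hU : UniqueDiffOn ℝ (Ico 0 τ₀ ×ˢ D) := (uniqueDiffOn_Ico 0 τ₀).prod hD
  have hc := (hf.continuousOn_fderivWithin hU (by simp)).clm_apply
    (continuousOn_const (c := ((0 : ℝ), EuclideanSpace.single i (1 : ℝ))))
  refine hc.congr fun q hq => ?_
  obtain ⟨τ, x⟩ := q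
  have h1 := (hf.differentiableOn (by simp) (τ, x) hq).hasFDerivWithinAt
  have h2 : HasFDerivWithinAt (fun y : Space d => (τ, y))
      (ContinuousLinearMap.inr ℝ ℝ (Space d)) D x := (hasFDerivAt_prodMk_right τ x).hasFDerivWithinAt
  have h3 := (h1.comp x h2 fun y hy => ⟨hq.1, hy⟩).fderivWithin (hD x hq.2)
  rw [pd]
  have h4 : fderivWithin ℝ (f τ) D x = _ := h3
  simp [h4]

/-- The functions `f τ` converge to `f₀` pointwise on `Ω` as `τ → 0+`, and they are uniformly
bounded for small `τ`. -/
def ConvergesBoundedly (Ω : Set (Space d)) (f : ℝ → Space d → ℝ) (f₀ : Space d → ℝ) : Prop :=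
  (∃ C, ∀ᶠ τ in 𝓝[>] (0 : ℝ), ∀ x ∈ Ω, |f τ x| ≤ C) ∧
    ∀ x ∈ Ω, Tendsto (fun τ => f τ x) (𝓝[>] 0) (𝓝 (f₀ x))

variable {f₀ g₀ : Space d → ℝ}

theorem ConvergesBoundedly.add (hf : ConvergesBoundedly Ω f f₀) (hg : ConvergesBoundedly Ω g g₀) :
    ConvergesBoundedly Ω (fun τ x => f τ x + g τ x) fun x => f₀ x + g₀ x := by
  obtain ⟨⟨A, hA⟩, hf'⟩ := hf
  obtain ⟨⟨B, hB⟩, hg'⟩ := hg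
  refine ⟨⟨A + B, ?_⟩, fun x hx => (hf' x hx).add (hg' x hx)⟩
  filter_upwards [hA, hB] with τ h1 h2 x hx
  exact (abs_add_le _ _).trans (add_le_add (h1 x hx) (h2 x hx))

theorem ConvergesBoundedly.mul (hf : ConvergesBoundedly Ω f f₀) (hg : ConvergesBoundedly Ω g g₀) :
    ConvergesBoundedly Ω (fun τ x => f τ x * g τ x) fun x => f₀ x * g₀ x := by
  obtain ⟨⟨A, hA⟩, hf'⟩ := hf
  obtain ⟨⟨B, hB⟩, hg'⟩ := hg
  refine ⟨⟨A * B, ?_⟩, fun x hx => (hf' x hx).mul (hg' x hx)⟩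
  filter_upwards [hA, hB] with τ h1 h2 x hx
  rw [abs_mul]
  exact mul_le_mul (h1 x hx) (h2 x hx) (abs_nonneg _) ((abs_nonneg _).trans (h1 x hx))

theorem ConvergesBoundedly.const (c : ℝ) : ConvergesBoundedly Ω (fun _ _ => c) fun _ => c :=
  ⟨⟨|c|, Eventually.of_forall fun _ _ _ => le_rfl⟩, fun _ _ => tendsto_const_nhds⟩

theorem ConvergesBoundedly.sum {ι : Type*} {s : Finset ι} {F : ι → ℝ → Space d → ℝ}
    {F₀ : ι → Space d → ℝ} (hF : ∀ k, ConvergesBoundedly Ω (F k) (F₀ k)) :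
    ConvergesBoundedly Ω (fun τ x => ∑ k ∈ s, F k τ x) fun x => ∑ k ∈ s, F₀ k x := by
  classical
  induction s using Finset.induction_on with
  | empty => simpa using ConvergesBoundedly.const 0
  | insert k s hk ih => simpa [Finset.sum_insert hk] using (hF k).add ih

theorem ConvergesBoundedly.congr (hf : ConvergesBoundedly Ω f f₀)
    (h : ∀ᶠ τ in 𝓝[>] (0 : ℝ), ∀ x ∈ Ω, f τ x = g τ x) : ConvergesBoundedly Ω g f₀ := by
  obtain ⟨⟨A, hA⟩, hf'⟩ := hf
  refine ⟨⟨A, ?_⟩, fun x hx => (hf' x hx).congr' (h.mono fun τ hτ => hτ x hx)⟩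
  filter_upwards [hA, h] with τ h1 h2 x hx
  rw [← h2 x hx]
  exact h1 x hx

theorem tendsto_slice (hf : ContinuousOn (fun q : ℝ × Space d => f q.1 q.2) (Ico 0 τ₀ ×ˢ D))
    (hτ₀ : 0 < τ₀) {x : Space d} (hx : x ∈ D) :
    Tendsto (fun τ => f τ x) (𝓝[>] 0) (𝓝 (f 0 x)) := by
  have h1 : ContinuousWithinAt (fun q : ℝ × Space d => f q.1 q.2) (Ico 0 τ₀ ×ˢ D) (0, x) :=
    hf (0, x) ⟨⟨le_rfl, hτ₀⟩, hx⟩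
  have h2 : Tendsto (fun τ : ℝ => (τ, x)) (𝓝[>] 0) (𝓝[Ico 0 τ₀ ×ˢ D] (0, x)) := by
    refine tendsto_nhdsWithin_iff.2 ⟨?_, ?_⟩
    · exact (Continuous.prodMk_left x).continuousAt.tendsto.mono_left nhdsWithin_le_nhds
    · filter_upwards [Ioo_mem_nhdsGT hτ₀] with τ hτ using ⟨⟨hτ.1.le, hτ.2⟩, hx⟩
  exact h1.tendsto.comp h2

/-- A jointly continuous family converges boundedly, since `[0, τ₀ / 2] × closure Ω` is compact. -/
theorem BoundaryCondition.IsDomain.convergesBoundedly (hΩ : bc.IsDomain Ω) (hτ₀ : 0 < τ₀)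
    (hf : ContinuousOn (fun q : ℝ × Space d => f q.1 q.2) (Ico 0 τ₀ ×ˢ bc.region Ω)) :
    ConvergesBoundedly Ω f (f 0) := by
  refine ⟨?_, fun x hx => tendsto_slice hf hτ₀ (bc.subset_region Ω hx)⟩
  obtain ⟨C, hC⟩ := ((isCompact_Icc (a := 0) (b := τ₀ / 2)).prod
    hΩ.isCompact_closure).exists_bound_of_continuousOn (hf.mono (prod_mono
      (Icc_subset_Ico_right (by linarith)) (bc.closure_subset_region Ω)))
  refine ⟨C, ?_⟩
  filter_upwards [Ioo_mem_nhdsGT (half_pos hτ₀)] with τ hτ x hx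
  exact hC (τ, x) ⟨⟨hτ.1.le, hτ.2.le⟩, subset_closure hx⟩

theorem ConvergesBoundedly.tendsto_integral (hf : ConvergesBoundedly Ω f f₀)
    (hΩ : MeasurableSet Ω) (hfin : volume Ω ≠ ⊤)
    (hm : ∀ᶠ τ in 𝓝[>] (0 : ℝ), AEStronglyMeasurable (f τ) (volume.restrict Ω)) :
    Tendsto (fun τ => ∫ x in Ω, f τ x) (𝓝[>] 0) (𝓝 (∫ x in Ω, f₀ x)) := by
  obtain ⟨⟨C, hC⟩, hf'⟩ := hf
  refine tendsto_integral_filter_of_dominated_convergence (fun _ => C) hm ?_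
    (integrableOn_const hfin) (ae_restrict_of_forall_mem hΩ hf')
  exact hC.mono fun τ hτ => ae_restrict_of_forall_mem hΩ hτ

variable {S : Set ℝ} {φ : ℝ → ℝ} {k : ℝ → Space d → ℝ}

/-- A continuous function of intermediate values between `f` and `g` converges boundedly when `f`
and `g` have the same limit. -/
theorem BoundaryCondition.IsDomain.convergesBoundedly_intermediate (hΩ : bc.IsDomain Ω)
    (hτ₀ : 0 < τ₀) (hS : S.OrdConnected) (hφ : ∀ u ∈ S, ContinuousAt φ u)
    (hf : ContinuousOn (fun q : ℝ × Space d => f q.1 q.2) (Ico 0 τ₀ ×ˢ bc.region Ω))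
    (hg : ContinuousOn (fun q : ℝ × Space d => g q.1 q.2) (Ico 0 τ₀ ×ˢ bc.region Ω))
    (hfS : ∀ τ ∈ Ico 0 τ₀, ∀ x ∈ bc.region Ω, f τ x ∈ S)
    (hgS : ∀ τ ∈ Ico 0 τ₀, ∀ x ∈ bc.region Ω, g τ x ∈ S)
    (hfg : ∀ x ∈ Ω, g 0 x = f 0 x) {θ : ℝ → Space d → ℝ} (hθ : ∀ τ x, θ τ x ∈ Icc (0 : ℝ) 1) :
    ConvergesBoundedly Ω (fun τ x => φ (f τ x + θ τ x * (g τ x - f τ x))) fun x => φ (f 0 x) := by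
  have h0 : (0 : ℝ) ∈ Ico 0 τ₀ := ⟨le_rfl, hτ₀⟩
  refine ⟨?_, fun x hx => ?_⟩
  · set A : Set (ℝ × Space d) := Icc 0 (τ₀ / 2) ×ˢ closure Ω
    have hA : A ⊆ Ico 0 τ₀ ×ˢ bc.region Ω :=
      prod_mono (Icc_subset_Ico_right (by linarith)) (bc.closure_subset_region Ω)
    have hcont : ContinuousOn (fun q : (ℝ × Space d) × ℝ =>
        φ (f q.1.1 q.1.2 + q.2 * (g q.1.1 q.1.2 - f q.1.1 q.1.2))) (A ×ˢ Icc (0 : ℝ) 1) := by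
      have e1 : ContinuousOn (fun q : (ℝ × Space d) × ℝ => f q.1.1 q.1.2) (A ×ˢ Icc (0 : ℝ) 1) :=
        (hf.mono hA).comp continuousOn_fst fun q hq => hq.1
      have e2 : ContinuousOn (fun q : (ℝ × Space d) × ℝ => g q.1.1 q.1.2) (A ×ˢ Icc (0 : ℝ) 1) :=
        (hg.mono hA).comp continuousOn_fst fun q hq => hq.1
      intro q hq
      have hq' := hA hq.1
      have hmem := add_mul_sub_mem hS (hfS _ hq'.1 _ hq'.2) (hgS _ hq'.1 _ hq'.2) hq.2
      exact ContinuousAt.comp_continuousWithinAt (g := φ)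
        (f := fun q : (ℝ × Space d) × ℝ =>
          f q.1.1 q.1.2 + q.2 * (g q.1.1 q.1.2 - f q.1.1 q.1.2)) (hφ _ hmem)
        ((e1.add (continuousOn_snd.mul (e2.sub e1))) q hq)
    obtain ⟨C, hC⟩ := (((isCompact_Icc (a := 0) (b := τ₀ / 2)).prod
      hΩ.isCompact_closure).prod isCompact_Icc).exists_bound_of_continuousOn hcont
    refine ⟨C, ?_⟩
    filter_upwards [Ioo_mem_nhdsGT (half_pos hτ₀)] with τ hτ x hx
    exact hC ((τ, x), θ τ x) ⟨⟨⟨hτ.1.le, hτ.2.le⟩, subset_closure hx⟩, hθ τ x⟩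
  · have hxD := bc.subset_region Ω hx
    refine (hφ _ (hfS 0 h0 x hxD)).tendsto.comp ?_
    have l1 := tendsto_slice hf hτ₀ hxD
    have l2 := tendsto_slice hg hτ₀ hxD
    have l3 : Tendsto (fun τ => θ τ x * (g τ x - f τ x)) (𝓝[>] 0) (𝓝 0) := by
      have l4 : Tendsto (fun τ => |g τ x - f τ x|) (𝓝[>] 0) (𝓝 0) := by
        have := (l2.sub l1).abs
        rwa [hfg x hx, sub_self, abs_zero] at this
      refine squeeze_zero_norm (fun τ => ?_) l4
      rw [norm_mul, Real.norm_of_nonneg (hθ τ x).1]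
      exact mul_le_of_le_one_left (norm_nonneg _) (hθ τ x).2
    simpa using l1.add l3

/-- First and second order difference quotients of `φ` along a perturbation `g = f + τ k`. -/
theorem BoundaryCondition.IsDomain.convergesBoundedly_quotients (hΩ : bc.IsDomain Ω)
    (hτ₀ : 0 < τ₀) (hS : S.OrdConnected) (hφ : ∀ u ∈ S, ContDiffAt ℝ ∞ φ u)
    (hf : ContinuousOn (fun q : ℝ × Space d => f q.1 q.2) (Ico 0 τ₀ ×ˢ bc.region Ω))
    (hg : ContinuousOn (fun q : ℝ × Space d => g q.1 q.2) (Ico 0 τ₀ ×ˢ bc.region Ω))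
    (hk : ContinuousOn (fun q : ℝ × Space d => k q.1 q.2) (Ico 0 τ₀ ×ˢ bc.region Ω))
    (hfS : ∀ τ ∈ Ico 0 τ₀, ∀ x ∈ bc.region Ω, f τ x ∈ S)
    (hgS : ∀ τ ∈ Ico 0 τ₀, ∀ x ∈ bc.region Ω, g τ x ∈ S)
    (hfg : ∀ τ ∈ Ico 0 τ₀, ∀ x ∈ Ω, g τ x = f τ x + τ * k τ x) :
    ConvergesBoundedly Ω (fun τ x => (φ (g τ x) - φ (f τ x)) / τ)
      (fun x => deriv φ (f 0 x) * k 0 x) ∧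
    ConvergesBoundedly Ω
      (fun τ x => (φ (g τ x) - φ (f τ x) - deriv φ (f τ x) * (g τ x - f τ x)) / τ ^ 2)
      (fun x => 1 / 2 * deriv (deriv φ) (f 0 x) * (k 0 x * k 0 x)) := by
  have h0 : ∀ x ∈ Ω, g 0 x = f 0 x := fun x hx => by
    rw [hfg 0 ⟨le_rfl, hτ₀⟩ x hx, zero_mul, add_zero]
  have hkc := hΩ.convergesBoundedly hτ₀ hk
  have hsmall : ∀ᶠ τ in 𝓝[>] (0 : ℝ), τ ∈ Ioo 0 τ₀ := Ioo_mem_nhdsGT hτ₀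
  constructor
  · have ex : ∀ τ x, ∃ t ∈ Icc (0 : ℝ) 1, τ ∈ Ico 0 τ₀ → x ∈ Ω → φ (g τ x) - φ (f τ x) =
        deriv φ (f τ x + t * (g τ x - f τ x)) * (g τ x - f τ x) := by
      intro τ x
      by_cases hτ : τ ∈ Ico 0 τ₀ ∧ x ∈ Ω
      · obtain ⟨t, ht, he⟩ := exists_sub_eq_deriv_mul hS hφ
          (hfS τ hτ.1 x (bc.subset_region Ω hτ.2)) (hgS τ hτ.1 x (bc.subset_region Ω hτ.2))
        exact ⟨t, ht, fun _ _ => he⟩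
      · exact ⟨0, by simp, fun h1 h2 => (hτ ⟨h1, h2⟩).elim⟩
    choose θ hθ hθe using ex
    refine ((hΩ.convergesBoundedly_intermediate hτ₀ hS (fun u hu =>
      (contDiffAt_infty_deriv (hφ u hu)).continuousAt) hf hg hfS hgS h0 hθ).mul hkc).congr ?_
    filter_upwards [hsmall] with τ hτ x hx
    have hτ' := Ioo_subset_Ico_self hτ
    rw [hθe τ x hτ' hx, show g τ x - f τ x = τ * k τ x by rw [hfg τ hτ' x hx]; ring]
    have := hτ.1.ne'
    field_simp
  · have ex : ∀ τ x, ∃ t ∈ Icc (0 : ℝ) 1, τ ∈ Ico 0 τ₀ → x ∈ Ω →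
        φ (g τ x) - φ (f τ x) - deriv φ (f τ x) * (g τ x - f τ x) =
        1 / 2 * deriv (deriv φ) (f τ x + t * (g τ x - f τ x)) * (g τ x - f τ x) ^ 2 := by
      intro τ x
      by_cases hτ : τ ∈ Ico 0 τ₀ ∧ x ∈ Ω
      · obtain ⟨t, ht, he⟩ := exists_sub_sub_eq_deriv_deriv_mul hS hφ
          (hfS τ hτ.1 x (bc.subset_region Ω hτ.2)) (hgS τ hτ.1 x (bc.subset_region Ω hτ.2))
        exact ⟨t, ht, fun _ _ => he⟩
      · exact ⟨0, by simp, fun h1 h2 => (hτ ⟨h1, h2⟩).elim⟩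
    choose θ hθ hθe using ex
    refine (((ConvergesBoundedly.const (1 / 2)).mul
      (hΩ.convergesBoundedly_intermediate hτ₀ hS (fun u hu => (contDiffAt_infty_deriv
        (contDiffAt_infty_deriv (hφ u hu))).continuousAt) hf hg hfS hgS h0 hθ)).mul
      (hkc.mul hkc)).congr ?_
    filter_upwards [hsmall] with τ hτ x hx
    have hτ' := Ioo_subset_Ico_self hτ
    rw [hθe τ x hτ' hx, show g τ x - f τ x = τ * k τ x by rw [hfg τ hτ' x hx]; ring]
    have := hτ.1.ne'
    field_simp

theorem BoundaryCondition.IsDomain.pd_congr (hΩ : bc.IsDomain Ω) {p q : Space d → ℝ}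
    (h : EqOn p q Ω) {x : Space d} (hx : x ∈ Ω) (i : Fin d) :
    pd (bc.region Ω) i p x = pd (bc.region Ω) i q x := by
  have hloc : p =ᶠ[𝓝 x] q := by
    filter_upwards [hΩ.isOpen.mem_nhds hx] with y hy using h hy
  rw [pd_eq_fderiv (hΩ.region_mem_nhds hx), pd_eq_fderiv (hΩ.region_mem_nhds hx), hloc.fderiv_eq]

/-- The difference quotient of the flux `a(f) ∂ₗ f` along a perturbation `g = f + τ k`. -/
theorem BoundaryCondition.IsDomain.convergesBoundedly_flux (hΩ : bc.IsDomain Ω)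
    (hτ₀ : 0 < τ₀) (hS : S.OrdConnected) (hφ : ∀ u ∈ S, ContDiffAt ℝ ∞ φ u)
    (hf : IsSmoothFamily τ₀ (bc.region Ω) f) (hg : IsSmoothFamily τ₀ (bc.region Ω) g)
    (hk : IsSmoothFamily τ₀ (bc.region Ω) k)
    (hfS : ∀ τ ∈ Ico 0 τ₀, ∀ x ∈ bc.region Ω, f τ x ∈ S)
    (hgS : ∀ τ ∈ Ico 0 τ₀, ∀ x ∈ bc.region Ω, g τ x ∈ S)
    (hfg : ∀ τ ∈ Ico 0 τ₀, ∀ x ∈ Ω, g τ x = f τ x + τ * k τ x) (l : Fin d) :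
    ConvergesBoundedly Ω (fun τ x => (φ (g τ x) * pd (bc.region Ω) l (g τ) x -
        φ (f τ x) * pd (bc.region Ω) l (f τ) x) / τ)
      (fun x => pd (bc.region Ω) l (fun y => φ (f 0 y) * k 0 y) x) := by
  have hD := hΩ.uniqueDiffOn
  have hsub := bc.subset_region Ω
  have h0 : (0 : ℝ) ∈ Ico 0 τ₀ := ⟨le_rfl, hτ₀⟩
  have hφf : ContinuousOn (fun q : ℝ × Space d => φ (f q.1 q.2)) (Ico 0 τ₀ ×ˢ bc.region Ω) :=
    fun q hq => ContinuousAt.comp_continuousWithinAt (g := φ)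
      (f := fun q : ℝ × Space d => f q.1 q.2) (hφ _ (hfS _ hq.1 _ hq.2)).continuousAt
      (hf.continuousOn q hq)
  have c1 := (hΩ.convergesBoundedly_quotients hτ₀ hS hφ hf.continuousOn hg.continuousOn
    hk.continuousOn hfS hgS hfg).1
  have c2 := hΩ.convergesBoundedly hτ₀ (f := fun τ => pd (bc.region Ω) l (g τ))
    (hg.continuousOn_pd hD l)
  have c3 := hΩ.convergesBoundedly hτ₀ (f := fun τ => pd (bc.region Ω) l (k τ))
    (hk.continuousOn_pd hD l)
  have c4 := hΩ.convergesBoundedly hτ₀ (f := fun τ x => φ (f τ x)) hφf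
  have hpd : ∀ τ ∈ Ico 0 τ₀, ∀ x ∈ Ω, pd (bc.region Ω) l (g τ) x =
      pd (bc.region Ω) l (f τ) x + τ * pd (bc.region Ω) l (k τ) x := by
    intro τ hτ x hx
    have hkd := (hk.slice hτ).differentiableOn (by simp)
    rw [hΩ.pd_congr (q := fun x => f τ x + τ * k τ x) (fun y hy => hfg τ hτ y hy) hx,
      pd_add hD (hsub hx) ((hf.slice hτ).differentiableOn (by simp)) (hkd.const_mul τ),
      pd_const_mul hD (hsub hx) hkd]
  have hlim : ∀ x ∈ Ω, pd (bc.region Ω) l (fun y => φ (f 0 y) * k 0 y) x =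
      deriv φ (f 0 x) * k 0 x * pd (bc.region Ω) l (g 0) x +
        φ (f 0 x) * pd (bc.region Ω) l (k 0) x := by
    intro x hx
    have hx' := hsub hx
    have hfd := (hf.slice h0).differentiableOn (by simp : (∞ : WithTop ℕ∞) ≠ 0)
    have hφd := (hφ _ (hfS 0 h0 x hx')).differentiableAt (by simp)
    rw [pd_mul hD hx' ((contDiffOn_comp_of_forall_mem hφ (hf.slice h0)
      (hfS 0 h0)).differentiableOn (by simp)) ((hk.slice h0).differentiableOn (by simp)),
      pd_comp hD hx' hfd hφd, hpd 0 h0 x hx]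
    ring
  have key := ((c1.mul c2).add (c4.mul c3)).congr (g := fun τ x =>
      (φ (g τ x) * pd (bc.region Ω) l (g τ) x - φ (f τ x) * pd (bc.region Ω) l (f τ) x) / τ) (by
    filter_upwards [Ioo_mem_nhdsGT hτ₀] with τ hτ x hx
    have := hτ.1.ne'
    rw [hpd τ (Ioo_subset_Ico_self hτ) x hx]
    field_simp
    ring)
  exact ⟨key.1, fun x hx => by simpa only [hlim x hx] using key.2 x hx⟩

end Families

end

/-! ### One step of the scheme -/

section

variable {d : ℕ} {bc : BoundaryCondition d} {Ω : Set (Space d)}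

theorem gradient_apply_eq_fderiv (f : Space d → ℝ) (x : Space d) (i : Fin d) :
    gradient f x i = fderiv ℝ f x (EuclideanSpace.single i 1) := by
  rw [← InnerProductSpace.toDual_symm_apply, EuclideanSpace.inner_single_right]
  simp [gradient]

theorem BoundaryCondition.IsDomain.norm_gradient_sq (hΩ : bc.IsDomain Ω) {x : Space d} (hx : x ∈ Ω)
    (f : Space d → ℝ) : ‖gradient f x‖ ^ 2 = ∑ i, pd (bc.region Ω) i f x ^ 2 := by
  rw [EuclideanSpace.real_norm_sq_eq]
  simp only [gradient_apply_eq_fderiv, pd_eq_fderiv (hΩ.region_mem_nhds hx)]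

theorem BoundaryCondition.IsDomain.neg_diffusionOp (hΩ : bc.IsDomain Ω) {x : Space d} (hx : x ∈ Ω)
    (a : ℝ → ℝ) (f : Space d → ℝ) :
    -diffusionOp a f x =
      ∑ i, pd (bc.region Ω) i (fun y => a (f y) * pd (bc.region Ω) i f y) x := by
  rw [diffusionOp, neg_neg, divergence]
  refine Finset.sum_congr rfl fun i _ => ?_
  rw [← pd_eq_fderiv (hΩ.region_mem_nhds hx)]
  refine hΩ.pd_congr (fun y hy => ?_) hx i
  simp [gradient_apply_eq_fderiv, pd_eq_fderiv (hΩ.region_mem_nhds hy)]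

variable {s : ℕ} {T : Tableau s} {S : Set ℝ} {a h : ℝ → ℝ}

/-- Weak form of `div (a(U) ∇U)`, tested with `h'(u)`. -/
theorem BoundaryCondition.IsDomain.integral_weak_form (hΩ : bc.IsDomain Ω)
    (ha : ∀ u ∈ S, ContDiffAt ℝ ∞ a u) (hh : ∀ u ∈ S, ContDiffAt ℝ ∞ h u) {u U : Space d → ℝ}
    (hu : ContDiffOn ℝ ∞ u (bc.region Ω)) (hU : ContDiffOn ℝ ∞ U (bc.region Ω))
    (huS : ∀ x ∈ bc.region Ω, u x ∈ S) (hUS : ∀ x ∈ bc.region Ω, U x ∈ S)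
    (hubc : bc.Holds Ω u) (hUbc : bc.Holds Ω U) :
    IntegrableOn (fun x => deriv h (u x) * -diffusionOp a U x + ∑ l, deriv (deriv h) (u x) *
        pd (bc.region Ω) l u x * (a (U x) * pd (bc.region Ω) l U x)) Ω ∧
      ∫ x in Ω, (deriv h (u x) * -diffusionOp a U x + ∑ l, deriv (deriv h) (u x) *
        pd (bc.region Ω) l u x * (a (U x) * pd (bc.region Ω) l U x)) = 0 := by
  have hD := hΩ.uniqueDiffOn
  have hsub := bc.subset_region Ω
  have sh1 : ∀ v ∈ S, ContDiffAt ℝ ∞ (deriv h) v := fun v hv => contDiffAt_infty_deriv (hh v hv)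
  have cw : ContDiffOn ℝ ∞ (fun x => deriv h (u x)) (bc.region Ω) :=
    contDiffOn_comp_of_forall_mem sh1 hu huS
  have caU : ContDiffOn ℝ ∞ (fun x => a (U x)) (bc.region Ω) :=
    contDiffOn_comp_of_forall_mem ha hU hUS
  have cpU := contDiffOn_pd hD hU
  have hJ := hΩ.integral_sum_pd_mul_pd hU hUbc (g := fun x => deriv h (u x) * a (U x))
    ((cw.mul caU).of_le (by norm_cast)) ((hubc.invariant.comp _).mul (hUbc.invariant.comp _))
  have cJ : ContinuousOn (fun x => ∑ i, pd (bc.region Ω) i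
      (fun y => deriv h (u y) * a (U y) * pd (bc.region Ω) i U y) x) (bc.region Ω) :=
    continuousOn_finsetSum _ fun i _ => (contDiffOn_pd hD ((cw.mul caU).mul (cpU i)) i).continuousOn
  have heq : EqOn (fun x => ∑ i, pd (bc.region Ω) i
      (fun y => deriv h (u y) * a (U y) * pd (bc.region Ω) i U y) x)
      (fun x => deriv h (u x) * -diffusionOp a U x + ∑ l, deriv (deriv h) (u x) *
        pd (bc.region Ω) l u x * (a (U x) * pd (bc.region Ω) l U x)) Ω := by
    intro x hxΩ
    have hx := hsub hxΩ
    beta_reduce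
    rw [hΩ.neg_diffusionOp hxΩ, Finset.mul_sum, ← Finset.sum_add_distrib]
    refine Finset.sum_congr rfl fun i _ => ?_
    simp_rw [mul_assoc (deriv h _)]
    rw [pd_mul hD hx (cw.differentiableOn (by simp)) ((caU.mul (cpU i)).differentiableOn (by simp)),
      pd_comp hD hx (hu.differentiableOn (by simp))
        ((sh1 _ (huS x hx)).differentiableAt (by simp))]
    ring
  have hm := hΩ.isOpen.measurableSet
  exact ⟨(hΩ.integrableOn cJ).congr_fun heq hm, by rw [← setIntegral_congr_fun hm heq]; exact hJ⟩

/-- The density of the entropy balance of one step of size `τ`, divided by `τ²`. -/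
def stepDensity (T : Tableau s) (a h : ℝ → ℝ) (D : Set (Space d)) (τ : ℝ) (v u : Space d → ℝ)
    (U : Fin s → Space d → ℝ) (x : Space d) : ℝ :=
  (h (v x) - h (u x) - deriv h (u x) * (v x - u x)) / τ ^ 2 +
    ∑ i, T.b i * ∑ l, deriv (deriv h) (u x) * pd D l u x *
      ((a (U i x) * pd D l (U i) x - a (u x) * pd D l u x) / τ)

/-- The entropy balance of one step: the terms of first order in `τ` cancel after
integration by parts. -/
theorem IsStep.entropy_balance (hΩ : bc.IsDomain Ω) (hT : T.IsConsistent)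
    (ha : ∀ u ∈ S, ContDiffAt ℝ ∞ a u) (hh : ∀ u ∈ S, ContDiffAt ℝ ∞ h u) {τ : ℝ} (hτ : 0 < τ)
    {v u : Space d → ℝ} {K : Fin s → Space d → ℝ} (hstep : IsStep T a S bc Ω τ v u K)
    (hv : ContDiffOn ℝ ∞ v (bc.region Ω)) (hu : ContDiffOn ℝ ∞ u (bc.region Ω))
    (hU : ∀ i, ContDiffOn ℝ ∞ (stage T τ v K i) (bc.region Ω)) :
    ContinuousOn (stepDensity T a h (bc.region Ω) τ v u (stage T τ v K)) (bc.region Ω) ∧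
    entropy h Ω v - entropy h Ω u - τ * entropyProduction a h Ω u =
      τ ^ 2 * ∫ x in Ω, stepDensity T a h (bc.region Ω) τ v u (stage T τ v K) x := by
  have hD := hΩ.uniqueDiffOn
  have hm := hΩ.isOpen.measurableSet
  have huS : ∀ x ∈ bc.region Ω, u x ∈ S := fun x hx => hstep.new_admissible.mem_of_mem_region hΩ hx
  have hvS : ∀ x ∈ bc.region Ω, v x ∈ S := fun x hx => hstep.old_admissible.mem_of_mem_region hΩ hx
  have hUS : ∀ i, ∀ x ∈ bc.region Ω, stage T τ v K i x ∈ S := fun i x hx =>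
    (hstep.stage_admissible i).mem_of_mem_region hΩ hx
  have sh1 : ∀ v ∈ S, ContDiffAt ℝ ∞ (deriv h) v := fun v hv => contDiffAt_infty_deriv (hh v hv)
  have chu := (contDiffOn_comp_of_forall_mem hh hu huS).continuousOn
  have chv := (contDiffOn_comp_of_forall_mem hh hv hvS).continuousOn
  have ch1 := (contDiffOn_comp_of_forall_mem sh1 hu huS).continuousOn
  have ch2 := (contDiffOn_comp_of_forall_mem
    (fun v hv => contDiffAt_infty_deriv (sh1 v hv)) hu huS).continuousOn
  have cau := (contDiffOn_comp_of_forall_mem ha hu huS).continuousOn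
  have caU := fun i => (contDiffOn_comp_of_forall_mem ha (hU i) (hUS i)).continuousOn
  have cpu := fun l => (contDiffOn_pd hD hu l).continuousOn
  have cpU := fun i l => (contDiffOn_pd hD (hU i) l).continuousOn
  have cΦ : ContinuousOn (stepDensity T a h (bc.region Ω) τ v u (stage T τ v K)) (bc.region Ω) :=
    (((chv.sub chu).sub (ch1.mul (hv.continuousOn.sub hu.continuousOn))).div_const _).add
      (continuousOn_finsetSum _ fun i _ => continuousOn_const.mul
        (continuousOn_finsetSum _ fun l _ => (ch2.mul (cpu l)).mul
          ((((caU i).mul (cpU i l)).sub (cau.mul (cpu l))).div_const _)))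
  refine ⟨cΦ, ?_⟩
  have cP : ContinuousOn (fun x => deriv (deriv h) (u x) * a (u x) *
      ∑ l, pd (bc.region Ω) l u x ^ 2) (bc.region Ω) :=
    (ch2.mul cau).mul (continuousOn_finsetSum _ fun l _ => (cpu l).pow 2)
  have hweak := fun i => hΩ.integral_weak_form ha hh hu (hU i) huS (hUS i) hstep.new_admissible.1
    (hstep.stage_admissible i).1
  have hP : entropyProduction a h Ω u = ∫ x in Ω, deriv (deriv h) (u x) * a (u x) *
      ∑ l, pd (bc.region Ω) l u x ^ 2 :=
    setIntegral_congr_fun hm fun x hx => by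
      rw [hΩ.norm_gradient_sq hx]
  have hzero : ∫ x in Ω, ∑ i, T.b i * (deriv h (u x) * -diffusionOp a (stage T τ v K i) x +
      ∑ l, deriv (deriv h) (u x) * pd (bc.region Ω) l u x *
        (a (stage T τ v K i x) * pd (bc.region Ω) l (stage T τ v K i) x)) = 0 := by
    rw [integral_finsetSum _ fun i _ => (hweak i).1.const_mul _]
    refine Finset.sum_eq_zero fun i _ => ?_
    rw [integral_const_mul, (hweak i).2, mul_zero]
  have ihv := hΩ.integrableOn chv
  have ihu := hΩ.integrableOn chu
  have iP := hΩ.integrableOn cP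
  have iΦ := hΩ.integrableOn cΦ
  have hpoint : ∀ x ∈ Ω, h (v x) - h (u x) - τ * (deriv (deriv h) (u x) * a (u x) *
      ∑ l, pd (bc.region Ω) l u x ^ 2) -
      τ ^ 2 * stepDensity T a h (bc.region Ω) τ v u (stage T τ v K) x =
      -τ * ∑ i, T.b i * (deriv h (u x) * -diffusionOp a (stage T τ v K i) x +
      ∑ l, deriv (deriv h) (u x) * pd (bc.region Ω) l u x *
        (a (stage T τ v K i x) * pd (bc.region Ω) l (stage T τ v K i) x)) := by
    intro x hx
    have e1 : v x - u x = -τ * ∑ i, T.b i * -diffusionOp a (stage T τ v K i) x := by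
      rw [hstep.new_eq x hx]
      simp_rw [fun i => hstep.increment_eq i x hx]
      ring
    have e2 : ∀ i, T.b i * ∑ l, deriv (deriv h) (u x) * pd (bc.region Ω) l u x *
        ((a (stage T τ v K i x) * pd (bc.region Ω) l (stage T τ v K i) x -
          a (u x) * pd (bc.region Ω) l u x) / τ) =
        τ⁻¹ * (T.b i * ∑ l, deriv (deriv h) (u x) * pd (bc.region Ω) l u x *
          (a (stage T τ v K i x) * pd (bc.region Ω) l (stage T τ v K i) x)) -
        T.b i * (τ⁻¹ * (deriv (deriv h) (u x) * a (u x) * ∑ l, pd (bc.region Ω) l u x ^ 2)) := by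
      intro i
      have : ∑ l, deriv (deriv h) (u x) * pd (bc.region Ω) l u x *
          ((a (stage T τ v K i x) * pd (bc.region Ω) l (stage T τ v K i) x -
            a (u x) * pd (bc.region Ω) l u x) / τ) =
          τ⁻¹ * (∑ l, deriv (deriv h) (u x) * pd (bc.region Ω) l u x *
            (a (stage T τ v K i x) * pd (bc.region Ω) l (stage T τ v K i) x)) -
          τ⁻¹ * (deriv (deriv h) (u x) * a (u x) * ∑ l, pd (bc.region Ω) l u x ^ 2) := by
        simp only [Finset.mul_sum, ← Finset.sum_sub_distrib]
        refine Finset.sum_congr rfl fun l _ => ?_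
        field_simp
      rw [this]
      ring
    have hb : ∑ i, T.b i = 1 := hT
    rw [stepDensity]
    simp_rw [e2]
    rw [Finset.sum_sub_distrib, ← Finset.sum_mul, hb, ← Finset.mul_sum, e1]
    simp_rw [mul_add, Finset.sum_add_distrib]
    have e3 : ∑ i, T.b i * (deriv h (u x) * -diffusionOp a (stage T τ v K i) x) =
        deriv h (u x) * ∑ i, T.b i * -diffusionOp a (stage T τ v K i) x := by
      rw [Finset.mul_sum]
      exact Finset.sum_congr rfl fun i _ => by ring
    rw [e3]
    field_simp
    ring
  have hint : ∫ x in Ω, (h (v x) - h (u x) - τ * (deriv (deriv h) (u x) * a (u x) *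
      ∑ l, pd (bc.region Ω) l u x ^ 2) -
      τ ^ 2 * stepDensity T a h (bc.region Ω) τ v u (stage T τ v K) x) = 0 := by
    rw [setIntegral_congr_fun hm hpoint, integral_const_mul, hzero, mul_zero]
  have i1 : IntegrableOn (fun x => h (v x) - h (u x)) Ω := ihv.sub ihu
  have i2 : IntegrableOn (fun x => h (v x) - h (u x) - τ * (deriv (deriv h) (u x) * a (u x) *
      ∑ l, pd (bc.region Ω) l u x ^ 2)) Ω := i1.sub (iP.const_mul τ)
  rw [integral_sub i2 (iΦ.const_mul _), integral_sub i1 (iP.const_mul τ), integral_sub ihv ihu,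
    integral_const_mul, integral_const_mul, ← hP] at hint
  rw [entropy, entropy]
  linarith

/-- The density of the entropy balance converges to half of the density of the second variation,
where `κ = div (a(u) ∇u)` at `τ = 0`. -/
theorem convergesBoundedly_stepDensity (hΩ : bc.IsDomain Ω) (hS : S.OrdConnected)
    (hT : T.IsConsistent) (ha : ∀ u ∈ S, ContDiffAt ℝ ∞ a u) (hh : ∀ u ∈ S, ContDiffAt ℝ ∞ h u)
    {τ₀ : ℝ} (hτ₀ : 0 < τ₀) {uOld uNew : ℝ → Space d → ℝ} {K : ℝ → Fin s → Space d → ℝ}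
    (hOld : IsSmoothFamily τ₀ (bc.region Ω) uOld) (hNew : IsSmoothFamily τ₀ (bc.region Ω) uNew)
    (hK : ∀ i, IsSmoothFamily τ₀ (bc.region Ω) fun τ => K τ i)
    (hU : ∀ i, IsSmoothFamily τ₀ (bc.region Ω) fun τ => stage T τ (uOld τ) (K τ) i)
    (hstep : ∀ τ ∈ Ico 0 τ₀, IsStep T a S bc Ω τ (uOld τ) (uNew τ) (K τ)) {κ : Space d → ℝ}
    (hκ : κ = fun x => ∑ i, pd (bc.region Ω) i
      (fun y => a (uNew 0 y) * pd (bc.region Ω) i (uNew 0) y) x) :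
    ConvergesBoundedly Ω (fun τ => stepDensity T a h (bc.region Ω) τ (uOld τ) (uNew τ)
      (stage T τ (uOld τ) (K τ)))
      (fun x => 1 / 2 * (deriv (deriv h) (uNew 0 x) * κ x ^ 2 - T.CRK *
        ∑ l, deriv (deriv h) (uNew 0 x) * pd (bc.region Ω) l (uNew 0) x *
          pd (bc.region Ω) l (fun y => a (uNew 0 y) * κ y) x)) := by
  have hD := hΩ.uniqueDiffOn
  have hsub := bc.subset_region Ω
  have h0 : (0 : ℝ) ∈ Ico 0 τ₀ := ⟨le_rfl, hτ₀⟩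
  have huS : ∀ τ ∈ Ico 0 τ₀, ∀ x ∈ bc.region Ω, uNew τ x ∈ S := fun τ hτ x hx =>
    (hstep τ hτ).new_admissible.mem_of_mem_region hΩ hx
  have hvS : ∀ τ ∈ Ico 0 τ₀, ∀ x ∈ bc.region Ω, uOld τ x ∈ S := fun τ hτ x hx =>
    (hstep τ hτ).old_admissible.mem_of_mem_region hΩ hx
  have hUS : ∀ i, ∀ τ ∈ Ico 0 τ₀, ∀ x ∈ bc.region Ω, stage T τ (uOld τ) (K τ) i x ∈ S :=
    fun i τ hτ x hx => ((hstep τ hτ).stage_admissible i).mem_of_mem_region hΩ hx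
  -- at `τ = 0` all increments coincide with `κ`
  have hvu0 : EqOn (uOld 0) (uNew 0) Ω := fun x hx => by
    simpa using ((hstep 0 h0).new_eq x hx).symm
  have hK0 : ∀ i, EqOn (K 0 i) κ Ω := by
    intro i x hx
    have hst : EqOn (stage T 0 (uOld 0) (K 0) i) (uNew 0) Ω := fun y hy => by
      rw [stage, zero_mul, add_zero, hvu0 hy]
    rw [(hstep 0 h0).increment_eq i x hx, hΩ.neg_diffusionOp hx, hκ]
    refine Finset.sum_congr rfl fun l _ => hΩ.pd_congr (fun y hy => ?_) hx l
    rw [hst hy, hΩ.pd_congr hst hy]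
  -- the stages and the old value as perturbations of the new value
  set Z : Fin s → ℝ → Space d → ℝ := fun i τ x => ∑ j, (T.a i j - T.b j) * K τ j x with hZ
  have hZs : ∀ i, IsSmoothFamily τ₀ (bc.region Ω) (Z i) := fun i =>
    ContDiffOn.sum fun j _ => contDiffOn_const.mul (hK j)
  have hUZ : ∀ i, ∀ τ ∈ Ico 0 τ₀, ∀ x ∈ Ω,
      stage T τ (uOld τ) (K τ) i x = uNew τ x + τ * Z i τ x := by
    intro i τ hτ x hx
    rw [(hstep τ hτ).new_eq x hx, stage, hZ]
    simp only [sub_mul, Finset.sum_sub_distrib]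
    ring
  set k : ℝ → Space d → ℝ := fun τ x => ∑ j, -T.b j * K τ j x with hk
  have hks : IsSmoothFamily τ₀ (bc.region Ω) k :=
    ContDiffOn.sum fun j _ => contDiffOn_const.mul (hK j)
  have hvk : ∀ τ ∈ Ico 0 τ₀, ∀ x ∈ Ω, uOld τ x = uNew τ x + τ * k τ x := by
    intro τ hτ x hx
    rw [(hstep τ hτ).new_eq x hx, hk]
    simp only [neg_mul, Finset.sum_neg_distrib]
    ring
  have hb : ∑ j, T.b j = 1 := hT
  have hk0 : ∀ x ∈ Ω, k 0 x = -κ x := by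
    intro x hx
    simp only [hk]
    simp_rw [fun j => hK0 j hx]
    rw [← Finset.sum_mul, Finset.sum_neg_distrib, hb]
    ring
  have hZ0 : ∀ i, EqOn (Z i 0) (fun x => (T.c i - 1) * κ x) Ω := by
    intro i x hx
    simp only [hZ]
    simp_rw [fun j => hK0 j hx]
    rw [← Finset.sum_mul, Finset.sum_sub_distrib, hb, Tableau.c]
  have sh2 : ∀ v ∈ S, ContDiffAt ℝ ∞ (deriv (deriv h)) v := fun v hv =>
    contDiffAt_infty_deriv (contDiffAt_infty_deriv (hh v hv))
  have c1 := (hΩ.convergesBoundedly_quotients hτ₀ hS hh hNew.continuousOn hOld.continuousOn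
    hks.continuousOn huS hvS hvk).2
  have c2 := hΩ.convergesBoundedly hτ₀ (f := fun τ x => deriv (deriv h) (uNew τ x))
    (fun q hq => ContinuousAt.comp_continuousWithinAt (g := deriv (deriv h))
      (f := fun q : ℝ × Space d => uNew q.1 q.2) (sh2 _ (huS _ hq.1 _ hq.2)).continuousAt
      (hNew.continuousOn q hq))
  have c3 := fun l => hΩ.convergesBoundedly hτ₀ (f := fun τ => pd (bc.region Ω) l (uNew τ))
    (hNew.continuousOn_pd hD l)
  have c4 := fun i l => hΩ.convergesBoundedly_flux hτ₀ hS ha hNew (hU i) (hZs i) huS (hUS i)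
    (hUZ i) l
  have key := c1.add (ConvergesBoundedly.sum (s := Finset.univ) fun i =>
    (ConvergesBoundedly.const (T.b i)).mul
      (ConvergesBoundedly.sum (s := Finset.univ) fun l => (c2.mul (c3 l)).mul (c4 i l)))
  refine ⟨key.1, fun x hx => ?_⟩
  refine (key.2 x hx).mono_right (le_of_eq (congrArg 𝓝 ?_))
  have hx' := hsub hx
  have cκ : ContDiffOn ℝ ∞ κ (bc.region Ω) := by
    rw [hκ]
    exact ContDiffOn.sum fun i _ => contDiffOn_pd hD ((contDiffOn_comp_of_forall_mem ha
      (hNew.slice h0) (huS 0 h0)).mul (contDiffOn_pd hD (hNew.slice h0) i)) i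
  have haκ : DifferentiableOn ℝ (fun y => a (uNew 0 y) * κ y) (bc.region Ω) :=
    ((contDiffOn_comp_of_forall_mem ha (hNew.slice h0) (huS 0 h0)).mul cκ).differentiableOn
      (by simp)
  have e : ∀ i l, pd (bc.region Ω) l (fun y => a (uNew 0 y) * Z i 0 y) x =
      (T.c i - 1) * pd (bc.region Ω) l (fun y => a (uNew 0 y) * κ y) x := by
    intro i l
    rw [hΩ.pd_congr (q := fun y => (T.c i - 1) * (a (uNew 0 y) * κ y)) (fun y hy => by
      beta_reduce
      rw [hZ0 i hy]
      ring) hx, pd_const_mul hD hx' haκ]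
  beta_reduce
  simp_rw [e, hk0 x hx, Tableau.CRK]
  set Q := ∑ l, deriv (deriv h) (uNew 0 x) * pd (bc.region Ω) l (uNew 0) x *
    pd (bc.region Ω) l (fun y => a (uNew 0 y) * κ y) x with hQ
  have e2 : ∀ i, T.b i * ∑ l, deriv (deriv h) (uNew 0 x) * pd (bc.region Ω) l (uNew 0) x *
      ((T.c i - 1) * pd (bc.region Ω) l (fun y => a (uNew 0 y) * κ y) x) =
      -(T.b i * (1 - T.c i)) * Q := by
    intro i
    rw [hQ, Finset.mul_sum, Finset.mul_sum]
    exact Finset.sum_congr rfl fun l _ => by ring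
  simp_rw [e2]
  rw [← Finset.sum_mul, Finset.sum_neg_distrib]
  ring

end

end RungeKuttaEntropy

end

theorem theorem3 {d s : ℕ} (T : RungeKuttaEntropy.Tableau s) (hT : T.IsConsistent)
    -- the domain and the boundary condition
    (bc : RungeKuttaEntropy.BoundaryCondition d) (Ω : Set (EuclideanSpace ℝ (Fin d)))
    (hΩ : bc.IsDomain Ω)
    -- the interval of admissible values, the diffusion coefficient, the entropy density and
    -- the mobility `μ = a / h''`
    (S : Set ℝ) (hS : S.OrdConnected) (a h μ : ℝ → ℝ)
    (ha : ∀ u ∈ S, ContDiffAt ℝ ∞ a u) (hh : ∀ u ∈ S, ContDiffAt ℝ ∞ h u)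
    (hμ : ∀ u ∈ S, ContDiffAt ℝ ∞ μ u)
    (hdense : S ⊆ closure {u ∈ S | deriv (deriv h) u ≠ 0})
    (hμ_eq : ∀ u ∈ S, deriv (deriv h) u ≠ 0 → μ u = a u / deriv (deriv h) u)
    -- the structural conditions
    (ha_nonneg : ∀ u ∈ S, 0 ≤ a u) (hh_convex : ∀ u ∈ S, 0 ≤ deriv (deriv h) u)
    (u₀ : ℝ) (hu₀ : u₀ ∈ closure S)
    (hint : ∀ u ∈ S, IntervalIntegrable
      (fun v => μ v * deriv μ v * deriv (deriv h) v) MeasureTheory.volume u₀ u)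
    (hcond1 : ∀ u ∈ S, 0 ≤ RungeKuttaEntropy.bFun T.CRK μ h u₀ u)
    (hcond2 : ∀ u ∈ S, ((d : ℝ) - 1) / d * RungeKuttaEntropy.bFun T.CRK μ h u₀ u ≤
      (T.CRK + 1) * deriv (deriv h) u * μ u ^ 2)
    (hcond3 : ∀ u ∈ S,
      (T.CRK + 2) * μ u * deriv (deriv μ) u + (T.CRK - 1) * deriv μ u ^ 2 < 0)
    -- the smooth solutions `uOld τ = u^{k-1}`, `uNew τ = u^k` of the scheme with step size `τ`
    (τ₀ : ℝ) (hτ₀ : 0 < τ₀) (uOld uNew : ℝ → EuclideanSpace ℝ (Fin d) → ℝ)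
    (K : ℝ → Fin s → EuclideanSpace ℝ (Fin d) → ℝ)
    (hOld : RungeKuttaEntropy.IsSmoothFamily τ₀ (bc.region Ω) uOld)
    (hNew : RungeKuttaEntropy.IsSmoothFamily τ₀ (bc.region Ω) uNew)
    (hK : ∀ i, RungeKuttaEntropy.IsSmoothFamily τ₀ (bc.region Ω) (fun τ => K τ i))
    (hstep : ∀ τ ∈ Set.Ico 0 τ₀,
      RungeKuttaEntropy.IsStep T a S bc Ω τ (uOld τ) (uNew τ) (K τ))
    -- `u^k` is not a constant steady state
    (hnonconst : ¬ ∃ c : ℝ, ∀ x ∈ Ω, uNew 0 x = c) :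
    ∃ τk : ℝ, 0 < τk ∧ τk ≤ τ₀ ∧ ∀ τ : ℝ, 0 < τ → τ < τk →
      RungeKuttaEntropy.entropy h Ω (uNew τ) +
          τ * RungeKuttaEntropy.entropyProduction a h Ω (uNew τ) ≤
        RungeKuttaEntropy.entropy h Ω (uOld τ) := by
  have h0 : (0 : ℝ) ∈ Set.Ico 0 τ₀ := ⟨le_rfl, hτ₀⟩
  have hs : RungeKuttaEntropy.StructuralConditions d T.CRK S a h μ u₀ :=
    ⟨ha, hh, hμ, hdense, fun u hu => RungeKuttaEntropy.eq_mobility_mul ha hh hμ hdense hμ_eq hu,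
      hh_convex, hint, hcond1, hcond2, hcond3⟩
  have hU : ∀ i, RungeKuttaEntropy.IsSmoothFamily τ₀ (bc.region Ω)
      fun τ => RungeKuttaEntropy.stage T τ (uOld τ) (K τ) i := fun i =>
    ContDiffOn.add hOld (contDiff_fst.contDiffOn.mul
      (ContDiffOn.sum fun j _ => contDiffOn_const.mul (hK j)))
  have hpos := hs.second_variation_pos hS hΩ (hNew.slice h0) (hstep 0 h0).new_admissible.1
    (fun x hx => (hstep 0 h0).new_admissible.mem_of_mem_region hΩ hx) hnonconst rfl
  have hconv := RungeKuttaEntropy.convergesBoundedly_stepDensity hΩ hS hT ha hh hτ₀ hOld hNew hK hU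
    hstep rfl
  have hbal := fun τ (hτ : τ ∈ Set.Ioo 0 τ₀) =>
    RungeKuttaEntropy.IsStep.entropy_balance hΩ hT ha hh hτ.1 (hstep τ (Set.Ioo_subset_Ico_self hτ))
      (hOld.slice (Set.Ioo_subset_Ico_self hτ)) (hNew.slice (Set.Ioo_subset_Ico_self hτ))
      fun i => (hU i).slice (Set.Ioo_subset_Ico_self hτ)
  have hm := hΩ.isOpen.measurableSet
  have hlim := hconv.tendsto_integral hm
    ((MeasureTheory.measure_mono subset_closure).trans_lt hΩ.isCompact_closure.measure_lt_top).ne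
    (by
      filter_upwards [Ioo_mem_nhdsGT hτ₀] with τ hτ
      exact ((hbal τ hτ).1.mono (bc.subset_region Ω)).aestronglyMeasurable hm)
  rw [MeasureTheory.integral_const_mul] at hlim
  have hev := hlim.eventually_const_lt (mul_pos one_half_pos hpos)
  obtain ⟨r, hr, hsub⟩ := mem_nhdsGT_iff_exists_Ioo_subset.1 hev
  refine ⟨min r τ₀, lt_min hr hτ₀, min_le_right _ _, fun τ hτ hτk => ?_⟩
  have h1 : 0 < ∫ x in Ω, RungeKuttaEntropy.stepDensity T a h (bc.region Ω) τ (uOld τ) (uNew τ)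
      (RungeKuttaEntropy.stage T τ (uOld τ) (K τ)) x :=
    hsub ⟨hτ, hτk.trans_le (min_le_left _ _)⟩
  have h2 := (hbal τ ⟨hτ, hτk.trans_le (min_le_right _ _)⟩).2
  have h3 := mul_pos (pow_pos hτ 2) h1
  linarith
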